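/- Fix $\alpha>0$ and let $dA$ be the Lebesgue area measure on $\mathbb C$. For $1\le p<\infty$ let $F^p_\alpha$ be the space of entire functions $f$ with $$\|f\|_{\alpha,p}^p=\frac{p\alpha}{2\pi}\int_{\mathbb C}\bigl|f(z)e^{-\frac{\alpha}{2}|z|^2}\bigr|^p\,dA(z)<\infty,$$ let $F^\infty_\alpha$ be the space of entire functions with $\|f\|_{\alpha,\infty}=\sup_{z}|f(z)|e^{-\frac{\alpha}{2}|z|^2}<\infty$, and let $f^\infty_\alpha\subset F^\infty_\alpha$ be the closed subspace of those $f$ with $f(z)e^{-\frac{\alpha}{2}|z|^2}\to0$ as $|z|\to\infty$. Let $K_\alpha(z,w)=e^{\alpha z\overline w}$, and let $K$ be the linear span of the functions $K_\alpha(\cdot,w)$, $w\in\mathbb C$. For a positive Borel measure $\mu$ on $\mathbb C$ satisfying $$\int_{\mathbb C}|K_\alpha(z,w)|^2e^{-\alpha|w|^2}\,d\mu(w)<\infty\qquad\text{for all } z\in\mathbb C,\tag{2}$$ define $T_\mu$ on $K$ by $$T_\mu f(z)=\frac{\alpha}{\pi}\int_{\mathbb C}K_\alpha(z,w)f(w)e^{-\alpha|w|^2}\,d\mu(w).$$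 A bounded operator $T:X\to Y$ between Banach spaces is nuclear if $T=\sum_{j}x_j'\otimes y_j$ with $x_j'\in X'$, $y_j\in Y$ and $\sum_j\|x_j'\|\|y_j\|<\infty$, where $(x'\otimes y)(x)=x'(x)\,y$; its nuclear norm $\|T\|_{\mathcal N}$ is the infimum of $\sum_j\|x_j'\|\|y_j\|$ over all such representations (and $\infty$ if $T$ is not nuclear). We say that $T_\mu$ is nuclear from $X$ to $Y$, where $X$ is $F^p_\alpha$ ($1\le p<\infty$) or $f^\infty_\alpha$, in which $K$ is dense, if $T_\mu$ extends from $K$ to a nuclear operator $X\to Y$. **Theorem 3.7.** Let $1\le q\le p<\infty$ and $1\le s\le\infty$. For every positive Borel measure $\mu$ on $\mathbb C$ satisfying (2), the following are equivalent: 1. $T_\mu$ is nuclear from $F^p_\alpha$ to $F^q_\alpha$; 2. $T_\mu$ is nuclear from $f^\infty_\alpha$ to $F^s_\alpha$; 3. $\mu(\mathbb C)<\infty$. Moreover, there are constants $c,C>0$, depending only on $\alpha,p,q,s$, such that for every positive Borel measure $\mu$ satisfying (2), $$c\,\mu(\mathbb C)\le\|T_\mu\|_{\mathcal N}\le C\,\mu(\mathbb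 C)$$ whenever $T_\mu$ extends to a bounded operator $F^p_\alpha\to F^q_\alpha$, and likewise whenever it extends to a bounded operator $f^\infty_\alpha\to F^s_\alpha$, with $\|T_\mu\|_{\mathcal N}$ the nuclear norm of that extension. Consequently, if $T_\mu$ is nuclear from $F^p_\alpha$ to $F^q_\alpha$, then $T_\mu$ is nuclear from $F^{p_1}_\alpha$ to $F^{q_1}_\alpha$ for all $1\le q_1\le p_1<\infty$. -/

import Mathlib

open MeasureTheory Filter Topology
open scoped ENNReal NNReal ComplexConjugate

noncomputable section

namespace FockToeplitz

/-! ## Nuclear operators between normed spaces -/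

section Nuclear

variable {X Y : Type*} [NormedAddCommGroup X] [NormedSpace ℂ X]
  [NormedAddCommGroup Y] [NormedSpace ℂ Y]

/-- `T = ∑ j, φ j ⊗ y j` with `∑ j, ‖φ j‖ * ‖y j‖ < ∞`, where `φ j` lies in the dual of `X`,
`y j` lies in `Y`, and `(φ ⊗ y) x = φ x • y`. The series converges in the operator norm. -/
def IsNuclearRep (T : X →L[ℂ] Y) (φ : ℕ → (X →L[ℂ] ℂ)) (y : ℕ → Y) : Prop :=
  Summable (fun j => ‖φ j‖ * ‖y j‖) ∧
    HasSum (fun j => ContinuousLinearMap.smulRight (φ j) (y j)) T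

/-- A bounded operator is nuclear if it has a nuclear representation. -/
def IsNuclear (T : X →L[ℂ] Y) : Prop :=
  ∃ (φ : ℕ → (X →L[ℂ] ℂ)) (y : ℕ → Y), IsNuclearRep T φ y

/-- The nuclear norm: the infimum of `∑ j, ‖φ j‖ * ‖y j‖` over all nuclear representations.
It is `∞` exactly when `T` is not nuclear. -/
def nuclearNorm (T : X →L[ℂ] Y) : ℝ≥0∞ :=
  ⨅ (φ : ℕ → (X →L[ℂ] ℂ)) (y : ℕ → Y) (_ : IsNuclearRep T φ y), ∑' j, ‖φ j‖ₑ * ‖y j‖ₑ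

end Nuclear

/-! ## Fock spaces -/

/-- The function `z ↦ f z * exp (-α |z|² / 2)`. -/
def weighted (α : ℝ) (f : ℂ → ℂ) (z : ℂ) : ℂ :=
  f z * (Real.exp (-(α / 2) * ‖z‖ ^ 2) : ℂ)

/-- The entire functions `f` with `f z * exp (-α |z|² / 2)` in `L^p(ℂ, dA)`. -/
def fockSubmodule (α : ℝ) (p : ℝ≥0∞) : Submodule ℂ (ℂ → ℂ) where
  carrier := {f | Differentiable ℂ f ∧ MemLp (weighted α f) p volume}
  add_mem' := by
    rintro f g ⟨hf, hf'⟩ ⟨hg, hg'⟩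
    refine ⟨hf.add hg, ?_⟩
    have h : weighted α (f + g) = weighted α f + weighted α g := by
      ext z; simp [weighted, add_mul]
    rw [h]; exact hf'.add hg'
  zero_mem' := by
    refine ⟨differentiable_const _, ?_⟩
    have h : weighted α 0 = 0 := by ext z; simp [weighted]
    rw [h]; exact MemLp.zero
  smul_mem' := by
    rintro c f ⟨hf, hf'⟩
    refine ⟨hf.const_smul c, ?_⟩
    have h : weighted α (c • f) = c • weighted α f := by
      ext z; simp [weighted, mul_assoc]
    rw [h]; exact hf'.const_smul c

/-- The Fock space `F^p_α`. It is a type of its own, so that it carries the Fock norm and not the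
topology of pointwise convergence of the function space that contains it. -/
def Fock (α : ℝ) (p : ℝ≥0∞) : Type := fockSubmodule α p

namespace Fock

variable {α : ℝ} {p : ℝ≥0∞}

instance : AddCommGroup (Fock α p) := inferInstanceAs (AddCommGroup (fockSubmodule α p))

instance : Module ℂ (Fock α p) := inferInstanceAs (Module ℂ (fockSubmodule α p))

instance : FunLike (Fock α p) ℂ ℂ where
  coe f := f.1
  coe_injective := fun _ _ h => Subtype.ext h

theorem coe_add (f g : Fock α p) : ⇑(f + g) = f + g := rfl

theorem coe_smul (c : ℂ) (f : Fock α p) : ⇑(c • f) = c • ⇑f := rfl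

theorem differentiable (f : Fock α p) : Differentiable ℂ f := f.2.1

theorem memLp (f : Fock α p) : MemLp (weighted α f) p volume := f.2.2

/-- The normalizing factor of the Fock norm: `p α / (2 π)` for `p < ∞`, and `1` for `p = ∞`. -/
def normConst (α : ℝ) (p : ℝ≥0∞) : ℝ≥0∞ :=
  if p = ∞ then 1 else ENNReal.ofReal (p.toReal * α / (2 * Real.pi))

theorem normConst_ne_top : normConst α p ≠ ∞ := by
  unfold normConst; split_ifs <;> simp

theorem normConst_ne_zero [hα : Fact (0 < α)] [hp : Fact (1 ≤ p)] : normConst α p ≠ 0 := by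
  unfold normConst
  split_ifs with h
  · simp
  · have h1 : 0 < p.toReal := ENNReal.toReal_pos (zero_lt_one.trans_le hp.out).ne' h
    have h2 : 0 < α := hα.out
    have h3 : 0 < p.toReal * α / (2 * Real.pi) := by positivity
    simpa using h3

theorem memLp_smul (f : Fock α p) :
    MemLp (weighted α f) p (normConst α p • (volume : Measure ℂ)) :=
  f.memLp.smul_measure normConst_ne_top

/-- `f ↦ f z * exp (-α |z|² / 2)` as a linear map into `L^p` of the normalized area measure. -/
def toLp (α : ℝ) (p : ℝ≥0∞) :
    Fock α p →ₗ[ℂ] Lp ℂ p (normConst α p • (volume : Measure ℂ)) where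
  toFun f := f.memLp_smul.toLp
  map_add' f g := by
    have h : weighted α ⇑(f + g) = weighted α f + weighted α g := by
      ext z; simp [weighted, add_mul, coe_add]
    rw [← MemLp.toLp_add]
    exact MemLp.toLp_congr _ _ (by rw [h])
  map_smul' c f := by
    have h : weighted α ⇑(c • f) = c • weighted α f := by
      ext z; simp [weighted, mul_assoc, coe_smul]
    rw [RingHom.id_apply, ← MemLp.toLp_const_smul]
    exact MemLp.toLp_congr _ _ (by rw [h])

theorem toLp_injective [Fact (0 < α)] [Fact (1 ≤ p)] : Function.Injective (toLp α p) := by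
  intro f g hfg
  have h1 : weighted α f =ᵐ[normConst α p • (volume : Measure ℂ)] weighted α g :=
    (MemLp.toLp_eq_toLp_iff f.memLp_smul g.memLp_smul).1 hfg
  have h2 : weighted α f =ᵐ[(volume : Measure ℂ)] weighted α g :=
    (Measure.ae_ennreal_smul_measure_iff normConst_ne_zero).1 h1
  have hc : ∀ f : Fock α p, Continuous (weighted α f) := fun f => by
    have := f.differentiable.continuous
    unfold weighted; fun_prop
  have h3 := (Continuous.ae_eq_iff_eq volume (hc f) (hc g)).1 h2
  refine DFunLike.ext _ _ fun z => ?_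
  have h4 := congrFun h3 z
  simpa [weighted] using h4

/-- The Fock norm, `‖f‖^p = (p α / (2 π)) ∫ |f z * exp (-α |z|² / 2)|^p dA(z)` for `p < ∞` and
`‖f‖ = ess sup |f z| exp (-α |z|² / 2)` for `p = ∞`. -/
instance [Fact (0 < α)] [Fact (1 ≤ p)] : NormedAddCommGroup (Fock α p) :=
  NormedAddCommGroup.induced (Fock α p) (Lp ℂ p (normConst α p • (volume : Measure ℂ)))
    (toLp α p) toLp_injective

instance [Fact (0 < α)] [Fact (1 ≤ p)] : NormedSpace ℂ (Fock α p) :=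
  NormedSpace.induced ℂ (Fock α p) (Lp ℂ p (normConst α p • (volume : Measure ℂ))) (toLp α p)

theorem norm_def [Fact (0 < α)] [Fact (1 ≤ p)] (f : Fock α p) :
    ‖f‖ = (eLpNorm (weighted α f) p (normConst α p • (volume : Measure ℂ))).toReal :=
  Lp.norm_toLp _ f.memLp_smul

theorem norm_rpow [hα : Fact (0 < α)] [h1 : Fact (1 ≤ p)] (hp : p ≠ ∞) (f : Fock α p) :
    ‖f‖ ^ p.toReal =
      p.toReal * α / (2 * Real.pi) * ∫ z : ℂ, ‖weighted α f z‖ ^ p.toReal := by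
  have h0 : p ≠ 0 := (zero_lt_one.trans_le h1.out).ne'
  have hp0 : 0 < p.toReal := ENNReal.toReal_pos h0 hp
  have hα0 : 0 < α := hα.out
  have hc : 0 ≤ p.toReal * α / (2 * Real.pi) := by positivity
  have hn : 0 ≤ p.toReal * α / (2 * Real.pi) * ∫ z : ℂ, ‖weighted α f z‖ ^ p.toReal :=
    mul_nonneg hc (integral_nonneg fun z => by positivity)
  rw [norm_def, f.memLp_smul.eLpNorm_eq_integral_rpow_norm h0 hp, integral_smul_measure,
    normConst, if_neg hp, ENNReal.toReal_ofReal hc, smul_eq_mul,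
    ENNReal.toReal_ofReal (Real.rpow_nonneg hn _), ← Real.rpow_mul hn,
    inv_mul_cancel₀ hp0.ne', Real.rpow_one]

end Fock

/-- The closed subspace `f^∞_α` of `F^∞_α`: the functions with `f z * exp (-α |z|² / 2) → 0` as
`|z| → ∞`. It carries the norm of `F^∞_α`. -/
def fockVanishing (α : ℝ) : Submodule ℂ (Fock α ∞) where
  carrier := {f | Tendsto (weighted α f) (cocompact ℂ) (𝓝 0)}
  add_mem' := by
    intro f g hf hg
    have h : weighted α ⇑(f + g) = fun z => weighted α f z + weighted α g z := by
      ext z; simp [weighted, add_mul, Fock.coe_add]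
    simpa [h] using Tendsto.add hf hg
  zero_mem' := by
    have h : weighted α ⇑(0 : Fock α ∞) = fun _ => 0 := by
      ext z
      change (0 : ℂ) * _ = 0
      simp
    simp [h]
  smul_mem' := by
    intro c f hf
    have h : weighted α ⇑(c • f) = fun z => c * weighted α f z := by
      ext z; simp [weighted, mul_assoc, Fock.coe_smul]
    simpa [h] using Tendsto.const_mul c hf

instance (α : ℝ) : FunLike (fockVanishing α) ℂ ℂ where
  coe f := ⇑(f : Fock α ∞)
  coe_injective := fun _ _ h => Subtype.ext (DFunLike.coe_injective h)

/-! ## Toeplitz operators -/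

/-- The reproducing kernel `K_α(z, w) = exp (α z \bar w)`. -/
def kernel (α : ℝ) (z w : ℂ) : ℂ := Complex.exp (α * z * conj w)

/-- The linear span of the kernel functions `K_w = K_α(·, w)`, `w ∈ ℂ`. -/
def kernelSpan (α : ℝ) : Submodule ℂ (ℂ → ℂ) :=
  Submodule.span ℂ (Set.range fun w : ℂ => fun z : ℂ => kernel α z w)

/-- The integrability condition `∫ |K_α(z, w)|² exp (-α |w|²) dμ(w) < ∞` for all `z`. -/
def Admissible (α : ℝ) (μ : Measure ℂ) : Prop :=
  ∀ z : ℂ, ∫⁻ w, ENNReal.ofReal (‖kernel α z w‖ ^ 2 * Real.exp (-α * ‖w‖ ^ 2)) ∂μ < ∞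

/-- `(T_μ f)(z) = (α / π) ∫ K_α(z, w) f(w) exp (-α |w|²) dμ(w)`. -/
def toeplitz (α : ℝ) (μ : Measure ℂ) (f : ℂ → ℂ) (z : ℂ) : ℂ :=
  ((α / Real.pi : ℝ) : ℂ) *
    ∫ w, kernel α z w * f w * (Real.exp (-α * ‖w‖ ^ 2) : ℂ) ∂μ

section Operator

variable {X Y : Type*} [NormedAddCommGroup X] [NormedSpace ℂ X] [FunLike X ℂ ℂ]
  [NormedAddCommGroup Y] [NormedSpace ℂ Y] [FunLike Y ℂ ℂ]

/-- The bounded operator `T : X → Y` between spaces of functions is (the extension of) `T_μ`: the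
span of the kernel functions lies in `X`, and `T` agrees with the integral formula on it. Where
that span is dense in `X` there is at most one such `T`. -/
def IsToeplitz (α : ℝ) (μ : Measure ℂ) (T : X →L[ℂ] Y) : Prop :=
  ∀ g ∈ kernelSpan α, ∃ f : X, ⇑f = g ∧ ⇑(T f) = toeplitz α μ g

variable (X Y) in
/-- `T_μ` belongs to the nuclear class `N(X, Y)`: it extends from the span of the kernel functions
to a nuclear operator from `X` to `Y`. -/
def ToeplitzNuclear (α : ℝ) (μ : Measure ℂ) : Prop :=
  ∃ T : X →L[ℂ] Y, IsToeplitz α μ T ∧ IsNuclear T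

end Operator

end FockToeplitz

end

/-!
The operator `T_μ` is a superposition of rank one operators: it is the integral over `μ` of `f ↦
(α / π) f(w) exp (-α |w|²) K_w`. Point evaluation at `w` and the kernel function `K_w` both have
norm comparable to `exp (α |w|² / 2)`, whatever the exponent of the Fock space, so that the
integrand has bounded norm.

*Finite measures give nuclear operators.* The normalized kernel functions depend continuously on
`w` and can be written as a series, with summable suprema, of functions with countably many
values. This turns the integral of rank one operators into an absolutely convergent series of rank
one operators whose total norm is at most a constant times `μ(ℂ)` (`exists_isNuclearRep_integral`,
`exists_toeplitz_of_isFiniteMeasure`). Any bounded extension of `T_μ` is the operator so obtained,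
because the kernel functions span a dense subspace (`eq_zero_of_forall_kernel`).

*Nuclear operators come from finite measures.* If `T_μ = ∑ φ_j ⊗ y_j`, then the integral of the
diagonal `(T_μ K_z)(z) exp (-α |z|²)` over a ball is the sum of the values of `φ_j` at `∫ y_j(z)
exp (-α |z|²) K_z dA(z)`, the integral being over the same ball. The latter is `π / α` times the
Bergman projection of a truncation of `y_j`; it is bounded in `F^p_α` by the norm of `y_j`, by
Young's inequality for Gaussians (`eLpNorm_le_of_le_gaussian`, `norm_truncatedProj_le`) and the
inclusion of `F^q_α` in `F^p_α` for `q ≤ p` (`Fock.eLpNorm_weighted_le`). On the other hand, the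
diagonal is the Berezin transform of `μ`, the convolution of `μ` with a Gaussian, whose integral
over the plane is `μ(ℂ)`. Letting the ball grow gives the lower bound for the nuclear norm
(`setLIntegral_gaussian_le`, `measure_univ_le_of_isNuclearRep`).

Density and the bounds on point evaluations rest on the reproducing formula `integral_mul_kernel`,
which is the mean value property of entire functions integrated against a Gaussian. Both domains
`F^p_α` and `f^∞_α` are treated as complete spaces `X` that embed isometrically, by `J`, in a Fock
space `F^p_α`, with `p = ∞` for the second one, and that contain the kernel functions.
-/

open MeasureTheory Filter Topology
open scoped ENNReal NNReal ComplexConjugate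

noncomputable section

namespace FockToeplitz

/-! ### Gaussian integrals and the reproducing formula -/

theorem integral_gaussian {b : ℝ} (hb : 0 < b) :
    ∫ z : ℂ, Real.exp (-b * ‖z‖ ^ 2) = Real.pi / b := by
  have h := GaussianFourier.integral_rexp_neg_mul_sq_norm (V := ℂ) hb
  rw [h, Complex.finrank_real_complex]
  norm_num

theorem integrable_gaussian {b : ℝ} (hb : 0 < b) :
    Integrable (fun z : ℂ => Real.exp (-b * ‖z‖ ^ 2)) := by
  refine Integrable.of_integral_ne_zero ?_
  rw [integral_gaussian hb]
  positivity

theorem lintegral_gaussian {b : ℝ} (hb : 0 < b) :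
    ∫⁻ z : ℂ, ENNReal.ofReal (Real.exp (-b * ‖z‖ ^ 2)) = ENNReal.ofReal (Real.pi / b) := by
  rw [← integral_gaussian hb, ofReal_integral_eq_lintegral_ofReal (integrable_gaussian hb)]
  exact .of_forall fun z => (Real.exp_pos _).le

/-- Mean value property of entire functions with respect to a Gaussian. The Gaussian is rotation
invariant, so the integrand may be averaged over rotations, which replaces `h z` by `h 0`. -/
theorem integral_gaussian_mul {b : ℝ} (hb : 0 < b) {h : ℂ → ℂ} (hh : Differentiable ℂ h)
    (hi : Integrable fun z : ℂ => h z * (Real.exp (-b * ‖z‖ ^ 2) : ℂ)) :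
    ∫ z : ℂ, h z * (Real.exp (-b * ‖z‖ ^ 2) : ℂ) = Real.pi / b * h 0 := by
  set F : ℂ → ℂ := fun z => h z * (Real.exp (-b * ‖z‖ ^ 2) : ℂ) with hF
  have hFc : Continuous F := by
    have := hh.continuous
    fun_prop
  -- rotations preserve the area measure
  have hrot : ∀ θ : ℝ, MeasurePreserving (fun z : ℂ => circleMap 0 1 θ * z) volume volume := by
    intro θ
    have := (rotation (Circle.exp θ)).measurePreserving
    convert! this using 2 with z
    simp [circleMap, rotation_apply]
  have hemb : ∀ θ : ℝ, MeasurableEmbedding (fun z : ℂ => circleMap 0 1 θ * z) := by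
    intro θ
    have := (rotation (Circle.exp θ)).toHomeomorph.measurableEmbedding
    convert! this using 2 with z
    simp [circleMap, rotation_apply]
  have h1 : ∀ θ : ℝ, ∫ z, F (circleMap 0 1 θ * z) = ∫ z, F z := fun θ =>
    (hrot θ).integral_comp (hemb θ) F
  have h2 : ∀ z : ℂ, ∫ θ in (0 : ℝ)..2 * Real.pi, F (circleMap 0 1 θ * z) =
      2 * Real.pi * (h 0 * (Real.exp (-b * ‖z‖ ^ 2) : ℂ)) := by
    intro z
    have hd : DiffContOnCl ℂ (fun u => h (u * z)) (Metric.ball 0 |(1 : ℝ)|) := by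
      apply Differentiable.diffContOnCl
      fun_prop
    have h3 := hd.circleAverage
    rw [Real.circleAverage_def] at h3
    have h4 : ∀ θ : ℝ, F (circleMap 0 1 θ * z) =
        h (circleMap 0 1 θ * z) * (Real.exp (-b * ‖z‖ ^ 2) : ℂ) := by
      intro θ
      simp [hF]
    simp_rw [h4]
    rw [intervalIntegral.integral_mul_const]
    have h5 : ∫ θ in (0 : ℝ)..2 * Real.pi, h (circleMap 0 1 θ * z) = 2 * Real.pi * h 0 := by
      have hpi : (2 * Real.pi : ℂ) ≠ 0 := by
        have := Real.pi_ne_zero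
        simp [this]
      rw [zero_mul] at h3
      rw [← h3]
      rw [Complex.real_smul]
      push_cast
      rw [mul_inv_cancel_left₀ hpi]
    rw [h5]
    ring
  have : IsFiniteMeasure (volume.restrict (Set.uIoc 0 (2 * Real.pi))) :=
    ⟨by simp [Set.uIoc]⟩
  have hint : Integrable (Function.uncurry fun (θ : ℝ) (z : ℂ) => F (circleMap 0 1 θ * z))
      ((volume.restrict (Set.uIoc 0 (2 * Real.pi))).prod volume) := by
    have hcont : Continuous (Function.uncurry fun (θ : ℝ) (z : ℂ) => F (circleMap 0 1 θ * z)) := by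
      have := continuous_circleMap 0 1
      fun_prop
    rw [integrable_prod_iff hcont.aestronglyMeasurable]
    refine ⟨.of_forall fun θ => ?_, ?_⟩
    · exact ((hrot θ).integrable_comp_emb (hemb θ)).2 hi
    · have h6 : ∀ θ : ℝ, ∫ z, ‖F (circleMap 0 1 θ * z)‖ = ∫ z, ‖F z‖ := fun θ =>
        (hrot θ).integral_comp (hemb θ) fun z => ‖F z‖
      simp only [Function.uncurry, h6]
      exact integrable_const _
  have h7 := intervalIntegral_integral_swap hint
  simp only [h1, h2] at h7
  rw [intervalIntegral.integral_const, integral_const_mul, integral_const_mul,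
    integral_complex_ofReal, integral_gaussian hb] at h7
  have hpi : (2 * Real.pi : ℂ) ≠ 0 := by
    have := Real.pi_ne_zero
    simp [this]
  have h8 : (2 * Real.pi : ℂ) * ∫ z, F z = 2 * Real.pi * (h 0 * (Real.pi / b : ℝ)) := by
    rw [← h7]
    simp
  rw [mul_left_cancel₀ hpi h8]
  push_cast
  ring

theorem norm_kernel (α : ℝ) (z w : ℂ) :
    ‖kernel α z w‖ = Real.exp (α / 2 * ‖z‖ ^ 2 + α / 2 * ‖w‖ ^ 2 - α / 2 * ‖z - w‖ ^ 2) := by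
  rw [kernel, Complex.norm_exp]
  congr 1
  simp only [← Complex.normSq_eq_norm_sq, Complex.normSq_apply]
  simp
  ring

theorem norm_weighted (α : ℝ) (f : ℂ → ℂ) (z : ℂ) :
    ‖weighted α f z‖ = ‖f z‖ * Real.exp (-(α / 2) * ‖z‖ ^ 2) := by
  rw [weighted, norm_mul, Complex.norm_real, Real.norm_of_nonneg (Real.exp_pos _).le]

theorem continuous_weighted (α : ℝ) {f : ℂ → ℂ} (hf : Continuous f) :
    Continuous (weighted α f) := by
  unfold weighted
  fun_prop

theorem continuous_kernel (α : ℝ) : Continuous fun x : ℂ × ℂ => kernel α x.1 x.2 := by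
  unfold kernel
  fun_prop

theorem differentiable_kernel (α : ℝ) (w : ℂ) : Differentiable ℂ fun z => kernel α z w := by
  unfold kernel
  fun_prop

theorem norm_weighted_kernel (α : ℝ) (z w : ℂ) :
    ‖weighted α (fun z => kernel α z w) z‖ =
      Real.exp (α / 2 * ‖w‖ ^ 2) * Real.exp (-(α / 2) * ‖z - w‖ ^ 2) := by
  rw [norm_weighted, norm_kernel, ← Real.exp_add, ← Real.exp_add]
  congr 1
  ring

theorem norm_mul_kernel_mul (α : ℝ) (f : ℂ → ℂ) (u z : ℂ) :
    ‖f z * kernel α u z * (Real.exp (-α * ‖z‖ ^ 2) : ℂ)‖ =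
      Real.exp (α / 2 * ‖u‖ ^ 2) * (Real.exp (-(α / 2) * ‖u - z‖ ^ 2) * ‖weighted α f z‖) := by
  have h : Real.exp (α / 2 * ‖u‖ ^ 2 + α / 2 * ‖z‖ ^ 2 - α / 2 * ‖u - z‖ ^ 2) *
      Real.exp (-α * ‖z‖ ^ 2) = Real.exp (α / 2 * ‖u‖ ^ 2) *
        (Real.exp (-(α / 2) * ‖u - z‖ ^ 2) * Real.exp (-(α / 2) * ‖z‖ ^ 2)) := by
    simp only [← Real.exp_add]
    congr 1
    ring
  rw [norm_weighted, norm_mul, norm_mul, norm_kernel, Complex.norm_real,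
    Real.norm_of_nonneg (Real.exp_pos _).le, mul_assoc, h]
  ring

/-- The reproducing formula of the kernel, for every entire function for which the integral makes
sense. It is the Gaussian mean value property of `v ↦ f (u + v) * exp (-α \bar u v)`. -/
theorem integral_mul_kernel {α : ℝ} (hα : 0 < α) {f : ℂ → ℂ} (hf : Differentiable ℂ f) (u : ℂ)
    (hi : Integrable fun z => f z * kernel α u z * (Real.exp (-α * ‖z‖ ^ 2) : ℂ)) :
    ∫ z, f z * kernel α u z * (Real.exp (-α * ‖z‖ ^ 2) : ℂ) = Real.pi / α * f u := by
  have h1 : ∀ v : ℂ, f (u + v) * kernel α u (u + v) * (Real.exp (-α * ‖u + v‖ ^ 2) : ℂ) =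
      f (u + v) * Complex.exp (-α * conj u * v) * (Real.exp (-α * ‖v‖ ^ 2) : ℂ) := by
    intro v
    rw [mul_assoc, mul_assoc, kernel, Complex.ofReal_exp, Complex.ofReal_exp, ← Complex.exp_add,
      ← Complex.exp_add]
    congr 2
    push_cast
    simp only [← Complex.mul_conj', map_add]
    ring
  have hi' := hi.comp_add_left u
  simp only [h1] at hi'
  have h2 := integral_gaussian_mul hα (h := fun v => f (u + v) * Complex.exp (-α * conj u * v))
    (by fun_prop) hi'
  rw [← integral_add_left_eq_self _ u]
  simp only [h1]
  simpa using h2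

/-! ### Convolution with a Gaussian -/

/-- Averaging translates of a function with respect to a probability measure does not increase its
`L^p` seminorm. -/
theorem eLpNorm_lintegral_sub_le (γ : Measure ℂ) [IsProbabilityMeasure γ] (hγ : γ ≪ volume)
    {p : ℝ≥0∞} (hp : 1 ≤ p) {g : ℂ → ℝ≥0∞} (hg : Measurable g) :
    eLpNorm (fun u => ∫⁻ v, g (u - v) ∂γ) p volume ≤ eLpNorm g p volume := by
  have hm : Measurable (Function.uncurry fun u v : ℂ => g (u - v)) :=
    hg.comp (measurable_fst.sub measurable_snd)
  rcases eq_or_ne p ∞ with rfl | hp'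
  · simp only [eLpNorm_exponent_top]
    refine essSup_le_of_ae_le _ (ae_of_all _ fun u => ?_)
    have h1 : ∀ᵐ v ∂γ, g (u - v) ≤ essSup g volume :=
      hγ.ae_le
        ((Measure.measurePreserving_sub_left volume u).quasiMeasurePreserving.ae ae_le_essSup)
    have h2 := lintegral_mono_ae h1
    rw [lintegral_const, measure_univ, mul_one] at h2
    exact h2
  · have hp0 : p ≠ 0 := (zero_lt_one.trans_le hp).ne'
    have hr : 0 < p.toReal := ENNReal.toReal_pos hp0 hp'
    rw [eLpNorm_eq_lintegral_rpow_enorm_toReal hp0 hp',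
      eLpNorm_eq_lintegral_rpow_enorm_toReal hp0 hp']
    refine ENNReal.rpow_le_rpow ?_ (by positivity)
    simp only [enorm_eq_self]
    have h1 : ∀ u, (∫⁻ v, g (u - v) ∂γ) ^ p.toReal ≤ ∫⁻ v, g (u - v) ^ p.toReal ∂γ := by
      intro u
      have h2 := eLpNorm_le_eLpNorm_of_exponent_le (μ := γ) (f := fun v => g (u - v)) hp
        (hg.comp (measurable_const.sub measurable_id)).aestronglyMeasurable
      rw [eLpNorm_one_eq_lintegral_enorm, eLpNorm_eq_lintegral_rpow_enorm_toReal hp0 hp', one_div,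
        ENNReal.le_rpow_inv_iff hr] at h2
      simpa using h2
    calc ∫⁻ u, (∫⁻ v, g (u - v) ∂γ) ^ p.toReal
        ≤ ∫⁻ u, ∫⁻ v, g (u - v) ^ p.toReal ∂γ := lintegral_mono h1
      _ = ∫⁻ v, (∫⁻ u, g (u - v) ^ p.toReal) ∂γ :=
          lintegral_lintegral_swap (hm.pow_const _).aemeasurable
      _ = ∫⁻ u, g u ^ p.toReal := by
          simp [lintegral_sub_right_eq_self (fun u => g u ^ p.toReal)]

theorem lintegral_gaussian_density {b : ℝ} (hb : 0 < b) :
    ∫⁻ v : ℂ, ENNReal.ofReal (b / Real.pi * Real.exp (-b * ‖v‖ ^ 2)) = 1 := by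
  have h0 : 0 < b / Real.pi := div_pos hb Real.pi_pos
  simp_rw [ENNReal.ofReal_mul h0.le]
  rw [lintegral_const_mul _ (by fun_prop), lintegral_gaussian hb, ← ENNReal.ofReal_mul h0.le]
  have := Real.pi_ne_zero
  field_simp
  simp

/-- Young's inequality for the convolution with a Gaussian, for a function `h` dominated by such a
convolution. -/
theorem eLpNorm_le_of_le_gaussian {b : ℝ} (hb : 0 < b) {p : ℝ≥0∞} (hp : 1 ≤ p)
    {g : ℂ → ℂ} (hg : Measurable g) {h : ℂ → ℂ} {C : ℝ} (hC : 0 ≤ C)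
    (hh : ∀ u, ‖h u‖ₑ ≤ ∫⁻ z, ENNReal.ofReal (C * Real.exp (-b * ‖u - z‖ ^ 2)) * ‖g z‖ₑ) :
    eLpNorm h p volume ≤ ENNReal.ofReal (C * Real.pi / b) * eLpNorm g p volume := by
  set ρ : ℂ → ℝ≥0∞ := fun v => ENNReal.ofReal (b / Real.pi * Real.exp (-b * ‖v‖ ^ 2)) with hρ
  have hρm : Measurable ρ := by fun_prop
  have : IsProbabilityMeasure ((volume : Measure ℂ).withDensity ρ) :=
    ⟨by rw [withDensity_apply _ .univ, setLIntegral_univ, lintegral_gaussian_density hb]⟩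
  have h1 := eLpNorm_lintegral_sub_le ((volume : Measure ℂ).withDensity ρ)
    (withDensity_absolutelyContinuous _ _) hp hg.enorm
  have h2 : ∀ u, ‖h u‖ₑ ≤ ((C * Real.pi / b).toNNReal : ℝ≥0∞) *
      ‖∫⁻ v, ‖g (u - v)‖ₑ ∂(volume : Measure ℂ).withDensity ρ‖ₑ := by
    intro u
    refine (hh u).trans_eq ?_
    rw [enorm_eq_self, lintegral_withDensity_eq_lintegral_mul _ hρm (by fun_prop),
      ← lintegral_const_mul _ (by fun_prop), ← lintegral_sub_left_eq_self _ u]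
    refine lintegral_congr fun z => ?_
    have h3 : ((C * Real.pi / b).toNNReal : ℝ≥0∞) * ρ z =
        ENNReal.ofReal (C * Real.exp (-b * ‖z‖ ^ 2)) := by
      rw [hρ]
      change ENNReal.ofReal _ * ENNReal.ofReal _ = _
      rw [← ENNReal.ofReal_mul (by positivity)]
      congr 1
      field_simp
    rw [Pi.mul_apply, ← mul_assoc, h3, sub_sub_cancel]
  refine (eLpNorm_le_nnreal_smul_eLpNorm_of_ae_le_mul' (ae_of_all _ h2) p).trans ?_
  rw [ENNReal.smul_def, smul_eq_mul]
  gcongr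
  · exact le_rfl
  · simpa using h1

/-! ### Fock spaces: point evaluations, completeness, kernel functions -/

theorem memLp_gaussian {b : ℝ} (hb : 0 < b) (p : ℝ≥0∞) :
    MemLp (fun z : ℂ => Real.exp (-b * ‖z‖ ^ 2)) p volume := by
  have hm : AEStronglyMeasurable (fun z : ℂ => Real.exp (-b * ‖z‖ ^ 2)) volume :=
    Continuous.aestronglyMeasurable (by fun_prop)
  have htop : MemLp (fun z : ℂ => Real.exp (-b * ‖z‖ ^ 2)) ∞ volume := by
    refine memLp_top_of_bound hm 1 (ae_of_all _ fun z => ?_)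
    rw [Real.norm_of_nonneg (Real.exp_pos _).le, Real.exp_le_one_iff]
    have : 0 ≤ b * ‖z‖ ^ 2 := by positivity
    linarith
  rcases eq_or_ne p ∞ with rfl | hp
  · exact htop
  rcases eq_or_ne p 0 with rfl | hp0
  · exact memLp_zero_iff_aestronglyMeasurable.2 hm
  have hr : 0 < p.toReal := ENNReal.toReal_pos hp0 hp
  rw [← integrable_norm_rpow_iff hm hp0 hp]
  refine (integrable_gaussian (b := b * p.toReal) (by positivity)).congr (ae_of_all _ fun z => ?_)
  dsimp only
  rw [Real.norm_of_nonneg (Real.exp_pos _).le, ← Real.exp_mul]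
  congr 1
  ring

namespace Fock

variable {α : ℝ} {p : ℝ≥0∞}

/-- The ratio between the norm of `F^p_α` and the `L^p` norm of the weighted function with respect
to the area measure. -/
def normFactor (α : ℝ) (p : ℝ≥0∞) : ℝ := (normConst α p ^ (1 / p).toReal).toReal

theorem continuous_weighted (f : Fock α p) : Continuous (weighted α f) :=
  FockToeplitz.continuous_weighted α f.differentiable.continuous

variable [hα : Fact (0 < α)] [hp : Fact (1 ≤ p)]

theorem normFactor_pos : 0 < normFactor α p :=
  ENNReal.toReal_pos
    (ENNReal.rpow_pos (pos_iff_ne_zero.2 normConst_ne_zero) normConst_ne_top).ne'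
    (ENNReal.rpow_ne_top_of_nonneg ENNReal.toReal_nonneg normConst_ne_top)

theorem norm_eq (f : Fock α p) :
    ‖f‖ = normFactor α p * (eLpNorm (weighted α f) p volume).toReal := by
  rw [norm_def, eLpNorm_smul_measure_of_ne_zero normConst_ne_zero, smul_eq_mul,
    ENNReal.toReal_mul, normFactor]

theorem norm_le_of_eLpNorm_le {f : Fock α p} {M : ℝ≥0∞} (hM : M ≠ ∞)
    (h : eLpNorm (weighted α f) p volume ≤ M) : ‖f‖ ≤ normFactor α p * M.toReal := by
  rw [norm_eq]
  exact mul_le_mul_of_nonneg_left (ENNReal.toReal_mono hM h) normFactor_pos.le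

variable (α p) in
/-- A bound for the norms of the point evaluations on `F^p_α`, with respect to the weight. -/
def evalBound : ℝ :=
  α / Real.pi *
    (eLpNorm (fun z : ℂ => Real.exp (-(α / 2) * ‖z‖ ^ 2)) p.conjExponent volume).toReal /
      normFactor α p

theorem integrable_gaussian_mul_weighted (f : Fock α p) (u : ℂ) :
    Integrable fun z => Real.exp (-(α / 2) * ‖u - z‖ ^ 2) • weighted α f z := by
  have h1 : MemLp (fun z => Real.exp (-(α / 2) * ‖u - z‖ ^ 2)) p.conjExponent volume :=
    (memLp_gaussian (half_pos hα.out) p.conjExponent).comp_measurePreserving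
      (Measure.measurePreserving_sub_left volume u)
  have := MemLp.smul (r := 1) f.memLp h1
  exact memLp_one_iff_integrable.1 this

theorem integral_gaussian_mul_weighted_le (f : Fock α p) (u : ℂ) :
    ∫ z, ‖Real.exp (-(α / 2) * ‖u - z‖ ^ 2) • weighted α f z‖ ≤
      Real.pi / α * evalBound α p * ‖f‖ := by
  have h0 := memLp_gaussian (half_pos hα.out) p.conjExponent
  have h1 := eLpNorm_smul_le_mul_eLpNorm (r := 1) (p := p.conjExponent) (q := p) (μ := volume)
    (f := weighted α f) (φ := fun z => Real.exp (-(α / 2) * ‖u - z‖ ^ 2)) f.memLp.1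
    (Continuous.aestronglyMeasurable (by fun_prop))
  have h2 : eLpNorm (fun z => Real.exp (-(α / 2) * ‖u - z‖ ^ 2)) p.conjExponent volume =
      eLpNorm (fun z : ℂ => Real.exp (-(α / 2) * ‖z‖ ^ 2)) p.conjExponent volume :=
    eLpNorm_comp_measurePreserving h0.1 (Measure.measurePreserving_sub_left volume u)
  rw [h2] at h1
  have h3 := ENNReal.toReal_mono
    (ENNReal.mul_lt_top h0.eLpNorm_lt_top f.memLp.eLpNorm_lt_top).ne h1
  rw [integral_norm_eq_lintegral_enorm (f.integrable_gaussian_mul_weighted u).1,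
    ← eLpNorm_one_eq_lintegral_enorm]
  refine h3.trans_eq ?_
  have h4 := (normFactor_pos (α := α) (p := p)).ne'
  have h5 := Real.pi_ne_zero
  have h6 := hα.out.ne'
  rw [ENNReal.toReal_mul, norm_eq, evalBound]
  field_simp

theorem evalBound_nonneg : 0 ≤ evalBound α p := by
  have h1 := (normFactor_pos (α := α) (p := p)).le
  have h2 := hα.out.le
  unfold evalBound
  positivity

theorem integrable_mul_kernel (f : Fock α p) (u : ℂ) :
    Integrable fun z => f z * kernel α u z * (Real.exp (-α * ‖z‖ ^ 2) : ℂ) := by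
  have hc : Continuous fun z => f z * kernel α u z * (Real.exp (-α * ‖z‖ ^ 2) : ℂ) := by
    have h1 := f.differentiable.continuous
    have h2 : Continuous fun z => kernel α u z :=
      (continuous_kernel α).comp (continuous_const.prodMk continuous_id)
    fun_prop
  refine ((f.integrable_gaussian_mul_weighted u).norm.const_mul
    (Real.exp (α / 2 * ‖u‖ ^ 2))).mono' hc.aestronglyMeasurable (ae_of_all _ fun z => ?_)
  rw [norm_mul_kernel_mul, norm_smul, Real.norm_of_nonneg (Real.exp_pos _).le]

theorem integral_mul_kernel (f : Fock α p) (u : ℂ) :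
    ∫ z, f z * kernel α u z * (Real.exp (-α * ‖z‖ ^ 2) : ℂ) = Real.pi / α * f u :=
  FockToeplitz.integral_mul_kernel hα.out f.differentiable u (f.integrable_mul_kernel u)

theorem norm_weighted_le (f : Fock α p) (u : ℂ) : ‖weighted α f u‖ ≤ evalBound α p * ‖f‖ := by
  have h1 := norm_integral_le_integral_norm (μ := volume)
    fun z => f z * kernel α u z * (Real.exp (-α * ‖z‖ ^ 2) : ℂ)
  have h2 : ∀ z, ‖f z * kernel α u z * (Real.exp (-α * ‖z‖ ^ 2) : ℂ)‖ =
      Real.exp (α / 2 * ‖u‖ ^ 2) * ‖Real.exp (-(α / 2) * ‖u - z‖ ^ 2) • weighted α f z‖ := by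
    intro z
    rw [norm_mul_kernel_mul, norm_smul, Real.norm_of_nonneg (Real.exp_pos _).le]
  simp only [h2] at h1
  rw [integral_mul_kernel, integral_const_mul] at h1
  have h3 := mul_le_mul_of_nonneg_left (f.integral_gaussian_mul_weighted_le u)
    (Real.exp_pos (α / 2 * ‖u‖ ^ 2)).le
  have h4 := h1.trans h3
  have hπ := Real.pi_pos
  have hα' := hα.out
  have h5 : ‖(Real.pi / α : ℂ) * f u‖ = Real.pi / α * ‖f u‖ := by
    rw [norm_mul, ← Complex.ofReal_div, Complex.norm_real, Real.norm_of_nonneg (by positivity)]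
  rw [h5] at h4
  have h6 : Real.pi / α * ‖f u‖ ≤
      Real.pi / α * (Real.exp (α / 2 * ‖u‖ ^ 2) * (evalBound α p * ‖f‖)) := by
    refine h4.trans_eq ?_
    ring
  have h7 := le_of_mul_le_mul_left h6 (by positivity)
  rw [norm_weighted]
  calc ‖f u‖ * Real.exp (-(α / 2) * ‖u‖ ^ 2)
      ≤ Real.exp (α / 2 * ‖u‖ ^ 2) * (evalBound α p * ‖f‖) * Real.exp (-(α / 2) * ‖u‖ ^ 2) := by
        gcongr
    _ = (Real.exp (α / 2 * ‖u‖ ^ 2) * Real.exp (-(α / 2) * ‖u‖ ^ 2)) *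
          (evalBound α p * ‖f‖) := by ring
    _ = evalBound α p * ‖f‖ := by
        rw [← Real.exp_add]
        simp

theorem norm_apply_le (f : Fock α p) (u : ℂ) :
    ‖f u‖ ≤ Real.exp (α / 2 * ‖u‖ ^ 2) * evalBound α p * ‖f‖ := by
  have h := f.norm_weighted_le u
  rw [norm_weighted, neg_mul, Real.exp_neg, ← div_eq_mul_inv, div_le_iff₀ (Real.exp_pos _)] at h
  linarith

/-- Point evaluation as a bounded functional on `F^p_α`. -/
def evalCLM (u : ℂ) : Fock α p →L[ℂ] ℂ :=
  LinearMap.mkContinuous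
    { toFun := fun f => f u
      map_add' := fun _ _ => rfl
      map_smul' := fun _ _ => rfl }
    (Real.exp (α / 2 * ‖u‖ ^ 2) * evalBound α p) fun f => f.norm_apply_le u

theorem evalCLM_apply (u : ℂ) (f : Fock α p) : evalCLM u f = f u := rfl

end Fock

namespace Fock

variable {α : ℝ} {p : ℝ≥0∞} [hα : Fact (0 < α)] [hp : Fact (1 ≤ p)]

theorem isometry_toLp : Isometry (toLp α p) := fun _ _ => rfl

/-- Norm convergence in a Fock space implies locally uniform convergence. -/
theorem tendstoUniformlyOn_of_cauchySeq {u : ℕ → Fock α p} (hu : CauchySeq u) {f : ℂ → ℂ}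
    (hf : ∀ z, Tendsto (fun n => u n z) atTop (𝓝 (f z))) (R : ℝ) :
    TendstoUniformlyOn (fun n z => u n z) f atTop (Metric.ball 0 R) := by
  refine UniformCauchySeqOn.tendstoUniformlyOn_of_tendsto ?_ fun z _ => hf z
  rw [Metric.uniformCauchySeqOn_iff]
  intro ε hε
  set B := Real.exp (α / 2 * R ^ 2) * evalBound α p with hB
  have hB0 : 0 ≤ B := mul_nonneg (Real.exp_pos _).le evalBound_nonneg
  have hα' := hα.out
  obtain ⟨N, hN⟩ := Metric.cauchySeq_iff.1 hu (ε / (B + 1)) (by positivity)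
  refine ⟨N, fun m hm n hn z hz => ?_⟩
  have hz' : ‖z‖ < R := by simpa using hz
  rw [dist_eq_norm]
  calc ‖u m z - u n z‖ = ‖(u m - u n) z‖ := rfl
    _ ≤ Real.exp (α / 2 * ‖z‖ ^ 2) * evalBound α p * ‖u m - u n‖ := norm_apply_le _ z
    _ ≤ B * ‖u m - u n‖ := by
        have := evalBound_nonneg (α := α) (p := p)
        rw [hB]
        gcongr
    _ ≤ (B + 1) * ‖u m - u n‖ := by gcongr; linarith
    _ < (B + 1) * (ε / (B + 1)) := by
        have := hN m hm n hn
        rw [dist_eq_norm] at this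
        gcongr
    _ = ε := by field_simp

instance : CompleteSpace (Fock α p) := by
  refine Metric.complete_of_cauchySeq_tendsto fun u hu => ?_
  have h1 : ∀ z, ∃ c, Tendsto (fun n => u n z) atTop (𝓝 c) := fun z =>
    cauchySeq_tendsto_of_complete
      ((evalCLM (α := α) (p := p) z).uniformContinuous.comp_cauchySeq hu)
  choose f hf using h1
  have hfd : Differentiable ℂ f := by
    intro z
    have h2 := (tendstoUniformlyOn_of_cauchySeq hu hf (‖z‖ + 1)).tendstoLocallyUniformlyOn
    have h3 := h2.differentiableOn (.of_forall fun n => (u n).differentiable.differentiableOn)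
      Metric.isOpen_ball
    exact h3.differentiableAt (Metric.isOpen_ball.mem_nhds (by simp))
  obtain ⟨g, hg⟩ :=
    cauchySeq_tendsto_of_complete (isometry_toLp.uniformContinuous.comp_cauchySeq hu)
  obtain ⟨ns, hns, hae⟩ := (tendstoInMeasure_of_tendsto_Lp hg).exists_seq_tendsto_ae
  have h4 : (g : ℂ → ℂ) =ᵐ[normConst α p • (volume : Measure ℂ)] weighted α f := by
    have h5 : ∀ᵐ z ∂(normConst α p • (volume : Measure ℂ)), ∀ n,
        (toLp α p (u n) : ℂ → ℂ) z = weighted α (u n) z :=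
      ae_all_iff.2 fun n => (u n).memLp_smul.coeFn_toLp
    filter_upwards [hae, h5] with z hz1 hz2
    refine tendsto_nhds_unique hz1 ?_
    simp only [Function.comp_apply, hz2]
    exact ((hf z).comp hns.tendsto_atTop).mul_const _
  have h6 : MemLp (weighted α f) p volume := by
    have h7 := (memLp_congr_ae h4).1 (Lp.memLp g)
    refine h7.of_measure_le_smul (c := (normConst α p)⁻¹)
      (ENNReal.inv_ne_top.2 normConst_ne_zero) ?_
    rw [smul_smul, ENNReal.inv_mul_cancel normConst_ne_zero normConst_ne_top, one_smul]
  let F : Fock α p := ⟨f, hfd, h6⟩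
  refine ⟨F, isometry_toLp.isEmbedding.tendsto_nhds_iff.2 ?_⟩
  have h8 : toLp α p F = g := by
    apply Lp.ext
    exact F.memLp_smul.coeFn_toLp.trans h4.symm
  rw [h8]
  exact hg

/-- The norm of the Gaussian in `L^p`, normalized as in `F^p_α`; it bounds the norms of the
normalized kernel functions. -/
def kernelBound (α : ℝ) (p : ℝ≥0∞) : ℝ :=
  normFactor α p * (eLpNorm (fun z : ℂ => Real.exp (-(α / 2) * ‖z‖ ^ 2)) p volume).toReal

omit hp in
theorem memLp_weighted_kernel (w : ℂ) :
    MemLp (weighted α fun z => kernel α z w) p volume := by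
  have h1 := ((memLp_gaussian (half_pos hα.out) p).comp_measurePreserving
    (measurePreserving_sub_right volume w)).const_mul (Real.exp (α / 2 * ‖w‖ ^ 2))
  refine h1.mono' ?_ (ae_of_all _ fun z => (norm_weighted_kernel α z w).le)
  exact (FockToeplitz.continuous_weighted α
    (differentiable_kernel α w).continuous).aestronglyMeasurable

variable (α p) in
/-- The kernel function `K_w`, as an element of `F^p_α`. -/
def kernelFun (w : ℂ) : Fock α p :=
  ⟨fun z => kernel α z w, differentiable_kernel α w, memLp_weighted_kernel w⟩

omit hp in
theorem coe_kernelFun (w : ℂ) : ⇑(kernelFun α p w) = fun z => kernel α z w := rfl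

theorem norm_kernelFun_le (w : ℂ) :
    ‖kernelFun α p w‖ ≤ Real.exp (α / 2 * ‖w‖ ^ 2) * kernelBound α p := by
  have h0 := memLp_gaussian (half_pos hα.out) p
  have h1 : eLpNorm (weighted α (kernelFun α p w)) p volume ≤
      ENNReal.ofReal (Real.exp (α / 2 * ‖w‖ ^ 2)) *
        eLpNorm (fun z : ℂ => Real.exp (-(α / 2) * ‖z‖ ^ 2)) p volume := by
    rw [← eLpNorm_comp_measurePreserving h0.1 (measurePreserving_sub_right volume w)]
    refine eLpNorm_le_mul_eLpNorm_of_ae_le_mul (ae_of_all _ fun z => ?_) p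
    refine (norm_weighted_kernel α z w).le.trans_eq ?_
    simp
  refine (norm_le_of_eLpNorm_le (ENNReal.mul_lt_top ENNReal.ofReal_lt_top h0.2).ne h1).trans_eq ?_
  rw [ENNReal.toReal_mul, ENNReal.toReal_ofReal (Real.exp_pos _).le, kernelBound]
  ring

theorem norm_weighted_kernel_sub_le {R : ℝ} {w w' : ℂ} (hw : ‖w‖ ≤ R) (hw' : ‖w'‖ ≤ R) (z : ℂ) :
    ‖weighted α (fun z => kernel α z w - kernel α z w') z‖ ≤
      Real.exp (α * (3 * R + 1) ^ 2) * ‖w - w'‖ * Real.exp (-(α / 4) * ‖z‖ ^ 2) := by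
  have hα' := hα.out
  have hR : 0 ≤ R := (norm_nonneg w).trans hw
  have h1 : kernel α z w - kernel α z w' =
      kernel α z w' * (Complex.exp (α * z * conj (w - w')) - 1) := by
    rw [mul_sub, mul_one, kernel, kernel, ← Complex.exp_add, map_sub]
    congr 2
    ring
  have h2 : ‖Complex.exp (α * z * conj (w - w')) - 1‖ ≤
      α * ‖z‖ * ‖w - w'‖ * Real.exp (α * ‖z‖ * ‖w - w'‖) := by
    have h3 := Complex.norm_exp_sub_sum_le_norm_mul_exp (α * z * conj (w - w')) 1
    have h4 : ‖(α : ℂ) * z * conj (w - w')‖ = α * ‖z‖ * ‖w - w'‖ := by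
      rw [norm_mul, norm_mul, Complex.norm_real, Real.norm_of_nonneg hα'.le, RCLike.norm_conj]
    rw [h4] at h3
    simpa using h3
  have h5 : ‖kernel α z w'‖ ≤ Real.exp (α * ‖z‖ * R) := by
    refine (Complex.norm_exp_le_exp_norm _).trans (Real.exp_le_exp.2 ?_)
    rw [norm_mul, norm_mul, Complex.norm_real, Real.norm_of_nonneg hα'.le, RCLike.norm_conj]
    gcongr
  have h6 : ‖w - w'‖ ≤ 2 * R := (norm_sub_le _ _).trans (by linarith)
  have h7 : α * ‖z‖ ≤ Real.exp (α * ‖z‖) := by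
    have := Real.add_one_le_exp (α * ‖z‖)
    linarith
  rw [norm_weighted, h1, norm_mul]
  calc ‖kernel α z w'‖ * ‖Complex.exp (α * z * conj (w - w')) - 1‖ *
        Real.exp (-(α / 2) * ‖z‖ ^ 2)
      ≤ Real.exp (α * ‖z‖ * R) * (Real.exp (α * ‖z‖) * ‖w - w'‖ *
          Real.exp (α * ‖z‖ * (2 * R))) * Real.exp (-(α / 2) * ‖z‖ ^ 2) := by
        gcongr
        refine h2.trans ?_
        gcongr
    _ = ‖w - w'‖ * Real.exp (α * ‖z‖ * R + α * ‖z‖ + α * ‖z‖ * (2 * R) + -(α / 2) * ‖z‖ ^ 2) := by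
        simp only [Real.exp_add]
        ring
    _ ≤ ‖w - w'‖ * Real.exp (α * (3 * R + 1) ^ 2 + -(α / 4) * ‖z‖ ^ 2) := by
        refine mul_le_mul_of_nonneg_left (Real.exp_le_exp.2 ?_) (norm_nonneg _)
        nlinarith [mul_nonneg hα'.le (sq_nonneg (‖z‖ / 2 - (3 * R + 1)))]
    _ = Real.exp (α * (3 * R + 1) ^ 2) * ‖w - w'‖ * Real.exp (-(α / 4) * ‖z‖ ^ 2) := by
        rw [Real.exp_add]
        ring

theorem continuous_kernelFun : Continuous (kernelFun α p) := by
  have hα' := hα.out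
  have h0 := memLp_gaussian (b := α / 4) (by positivity) p
  refine continuous_iff_continuousAt.2 fun w₀ => ?_
  refine continuousAt_of_locally_lipschitz one_pos
    (normFactor α p * Real.exp (α * (3 * (‖w₀‖ + 1) + 1) ^ 2) *
      (eLpNorm (fun z : ℂ => Real.exp (-(α / 4) * ‖z‖ ^ 2)) p volume).toReal) fun w hw => ?_
  rw [dist_eq_norm] at hw
  have hw1 : ‖w‖ ≤ ‖w₀‖ + 1 := by
    have := norm_sub_norm_le w w₀
    linarith
  have h1 : eLpNorm (weighted α ⇑(kernelFun α p w - kernelFun α p w₀)) p volume ≤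
      ENNReal.ofReal (Real.exp (α * (3 * (‖w₀‖ + 1) + 1) ^ 2) * ‖w - w₀‖) *
        eLpNorm (fun z : ℂ => Real.exp (-(α / 4) * ‖z‖ ^ 2)) p volume := by
    refine eLpNorm_le_mul_eLpNorm_of_ae_le_mul (ae_of_all _ fun z => ?_) p
    refine (norm_weighted_kernel_sub_le hw1 (by linarith) z).trans_eq ?_
    rw [Real.norm_of_nonneg (Real.exp_pos _).le]
  rw [dist_eq_norm, dist_eq_norm]
  refine (norm_le_of_eLpNorm_le (ENNReal.mul_lt_top ENNReal.ofReal_lt_top h0.2).ne h1).trans_eq ?_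
  rw [ENNReal.toReal_mul, ENNReal.toReal_ofReal (by positivity)]
  ring

end Fock

/-! ### Spaces of functions inside a Fock space -/

theorem eLpNorm_weighted_setIntegral_kernel_le {α : ℝ} (hα : 0 < α) {p : ℝ≥0∞} (hp : 1 ≤ p)
    {f : ℂ → ℂ} (hf : Continuous f) {t : Set ℂ} (ht : MeasurableSet t) :
    eLpNorm (weighted α fun u => ∫ z in t, f z * kernel α u z * (Real.exp (-α * ‖z‖ ^ 2) : ℂ))
      p volume ≤
        ENNReal.ofReal (2 * Real.pi / α) * eLpNorm (t.indicator (weighted α f)) p volume := by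
  have h0 := eLpNorm_le_of_le_gaussian (half_pos hα) hp
    (g := t.indicator (weighted α f)) (C := 1) (p := p)
    (h := weighted α fun u => ∫ z in t, f z * kernel α u z * (Real.exp (-α * ‖z‖ ^ 2) : ℂ))
    ((continuous_weighted α hf).measurable.indicator ht) zero_le_one ?_
  · have h1 : 1 * Real.pi / (α / 2) = 2 * Real.pi / α := by
      field_simp
    rwa [h1] at h0
  intro u
  rw [weighted, enorm_mul]
  have h2 : ∀ z, ‖f z * kernel α u z * (Real.exp (-α * ‖z‖ ^ 2) : ℂ)‖ₑ =
      ENNReal.ofReal (Real.exp (α / 2 * ‖u‖ ^ 2)) *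
        (ENNReal.ofReal (Real.exp (-(α / 2) * ‖u - z‖ ^ 2)) * ‖weighted α f z‖ₑ) := by
    intro z
    rw [← ofReal_norm, norm_mul_kernel_mul, ENNReal.ofReal_mul (Real.exp_pos _).le,
      ENNReal.ofReal_mul (Real.exp_pos _).le, ofReal_norm]
  have hm : Measurable fun z => ENNReal.ofReal (Real.exp (-(α / 2) * ‖u - z‖ ^ 2)) *
      ‖weighted α f z‖ₑ :=
    (Measurable.ennreal_ofReal (by fun_prop)).mul (continuous_weighted α hf).measurable.enorm
  have h3 : ENNReal.ofReal (Real.exp (α / 2 * ‖u‖ ^ 2)) *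
      ‖((Real.exp (-(α / 2) * ‖u‖ ^ 2) : ℝ) : ℂ)‖ₑ = 1 := by
    rw [← ofReal_norm, Complex.norm_real, Real.norm_of_nonneg (Real.exp_pos _).le,
      ← ENNReal.ofReal_mul (Real.exp_pos _).le, ← Real.exp_add]
    simp
  calc ‖∫ z in t, f z * kernel α u z * (Real.exp (-α * ‖z‖ ^ 2) : ℂ)‖ₑ *
        ‖((Real.exp (-(α / 2) * ‖u‖ ^ 2) : ℝ) : ℂ)‖ₑ
      ≤ (∫⁻ z in t, ‖f z * kernel α u z * (Real.exp (-α * ‖z‖ ^ 2) : ℂ)‖ₑ) *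
        ‖((Real.exp (-(α / 2) * ‖u‖ ^ 2) : ℝ) : ℂ)‖ₑ := by
        gcongr
        exact enorm_integral_le_lintegral_enorm _
    _ = ∫⁻ z in t, ENNReal.ofReal (Real.exp (-(α / 2) * ‖u - z‖ ^ 2)) * ‖weighted α f z‖ₑ := by
        simp_rw [h2]
        rw [lintegral_const_mul _ hm, mul_right_comm, h3, one_mul]
    _ = ∫⁻ z, ENNReal.ofReal (1 * Real.exp (-(α / 2) * ‖u - z‖ ^ 2)) *
          ‖t.indicator (weighted α f) z‖ₑ := by
        rw [← lintegral_indicator ht]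
        refine lintegral_congr fun z => ?_
        by_cases hz : z ∈ t <;> simp [hz]

section Subspace

variable {α : ℝ} [hα : Fact (0 < α)] {p q : ℝ≥0∞} [hp : Fact (1 ≤ p)] [hq : Fact (1 ≤ q)]
  {X : Type*} [NormedAddCommGroup X] [NormedSpace ℂ X]
  (J : X →ₗᵢ[ℂ] Fock α p) {k : ℂ → X}

/-- The integral `∫_s f(z) exp (-α |z|²) K_z dA(z)` in a space `X` with kernel functions `k z`. Up
to the factor `α / π`, it is the Bergman projection of the restriction of `f` to `s`. -/
def truncatedProj (α : ℝ) (k : ℂ → X) (s : Set ℂ) (f : ℂ → ℂ) : X :=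
  ∫ z in s, (f z * (Real.exp (-α * ‖z‖ ^ 2) : ℂ)) • k z

include J in
theorem continuous_of_isometry_kernelFun (hk : ∀ w, J (k w) = Fock.kernelFun α p w) :
    Continuous k := by
  rw [J.isometry.isEmbedding.continuous_iff]
  have : ⇑J ∘ k = Fock.kernelFun α p := funext hk
  rw [this]
  exact Fock.continuous_kernelFun

include J in
theorem norm_truncatedProj_integrand_le (hk : ∀ w, J (k w) = Fock.kernelFun α p w)
    (f : Fock α q) (z : ℂ) :
    ‖(f z * (Real.exp (-α * ‖z‖ ^ 2) : ℂ)) • k z‖ ≤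
      Fock.evalBound α q * Fock.kernelBound α p * ‖f‖ := by
  have h1 : ‖k z‖ ≤ Real.exp (α / 2 * ‖z‖ ^ 2) * Fock.kernelBound α p := by
    rw [← J.norm_map, hk]
    exact Fock.norm_kernelFun_le z
  have h2 := f.norm_weighted_le z
  have h3 : ‖f z * (Real.exp (-α * ‖z‖ ^ 2) : ℂ)‖ =
      ‖weighted α f z‖ * Real.exp (-(α / 2) * ‖z‖ ^ 2) := by
    rw [norm_weighted, norm_mul, Complex.norm_real, Real.norm_of_nonneg (Real.exp_pos _).le,
      mul_assoc, ← Real.exp_add]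
    congr 2
    ring
  have h4 : Real.exp (-(α / 2) * ‖z‖ ^ 2) * Real.exp (α / 2 * ‖z‖ ^ 2) = 1 := by
    rw [← Real.exp_add]
    simp
  rw [norm_smul, h3]
  calc ‖weighted α f z‖ * Real.exp (-(α / 2) * ‖z‖ ^ 2) * ‖k z‖
      ≤ (Fock.evalBound α q * ‖f‖) * Real.exp (-(α / 2) * ‖z‖ ^ 2) *
          (Real.exp (α / 2 * ‖z‖ ^ 2) * Fock.kernelBound α p) := by
        have := mul_nonneg (Fock.evalBound_nonneg (α := α) (p := q)) (norm_nonneg f)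
        gcongr
    _ = (Real.exp (-(α / 2) * ‖z‖ ^ 2) * Real.exp (α / 2 * ‖z‖ ^ 2)) *
          (Fock.evalBound α q * Fock.kernelBound α p * ‖f‖) := by ring
    _ = _ := by rw [h4, one_mul]

omit hq in
include J in
theorem continuous_truncatedProj_integrand (hk : ∀ w, J (k w) = Fock.kernelFun α p w)
    (f : Fock α q) : Continuous fun z => (f z * (Real.exp (-α * ‖z‖ ^ 2) : ℂ)) • k z := by
  have h1 := continuous_of_isometry_kernelFun J hk
  have h2 := f.differentiable.continuous
  fun_prop

include J in
theorem integrableOn_truncatedProj (hk : ∀ w, J (k w) = Fock.kernelFun α p w) (f : Fock α q)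
    {s : Set ℂ} (hs : volume s < ∞) :
    IntegrableOn (fun z => (f z * (Real.exp (-α * ‖z‖ ^ 2) : ℂ)) • k z) s :=
  Measure.integrableOn_of_bounded hs.ne
    (continuous_truncatedProj_integrand J hk f).aestronglyMeasurable
    (ae_of_all _ (norm_truncatedProj_integrand_le J hk f))

variable [CompleteSpace X]

theorem coe_truncatedProj (hk : ∀ w, J (k w) = Fock.kernelFun α p w) (f : Fock α q)
    {s : Set ℂ} (hs : volume s < ∞) :
    ⇑(J (truncatedProj α k s f)) =
      fun u => ∫ z in s, f z * kernel α u z * (Real.exp (-α * ‖z‖ ^ 2) : ℂ) := by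
  ext u
  have h := ((Fock.evalCLM u).comp J.toContinuousLinearMap).integral_comp_comm
    (integrableOn_truncatedProj J hk f hs)
  change Fock.evalCLM u (J (truncatedProj α k s f)) = _
  refine h.symm.trans (integral_congr_ae (ae_of_all _ fun z => ?_))
  change Fock.evalCLM u (J _) = _
  rw [map_smul, map_smul, hk, Fock.evalCLM_apply, Fock.coe_kernelFun, smul_eq_mul]
  ring

/-- The truncated projections of `f` are bounded by the `L^p` norm of the weighted function. -/
theorem norm_truncatedProj_le (hk : ∀ w, J (k w) = Fock.kernelFun α p w) (f : Fock α q)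
    (hf : MemLp (weighted α f) p volume) {s : Set ℂ} (hs : MeasurableSet s)
    (hs' : volume s < ∞) :
    ‖truncatedProj α k s f‖ ≤
      Fock.normFactor α p * (2 * Real.pi / α) * (eLpNorm (weighted α f) p volume).toReal := by
  have hα' := hα.out
  have hπ := Real.pi_pos
  have h1 : eLpNorm (weighted α ⇑(J (truncatedProj α k s f))) p volume ≤
      ENNReal.ofReal (2 * Real.pi / α) * eLpNorm (weighted α f) p volume := by
    rw [coe_truncatedProj J hk f hs']
    refine (eLpNorm_weighted_setIntegral_kernel_le hα' hp.out f.differentiable.continuous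
      hs).trans ?_
    gcongr
    exact eLpNorm_indicator_le _
  have h2 := Fock.norm_le_of_eLpNorm_le (ENNReal.mul_lt_top ENNReal.ofReal_lt_top hf.2).ne h1
  rw [J.norm_map, ENNReal.toReal_mul, ENNReal.toReal_ofReal (by positivity)] at h2
  rwa [mul_assoc]

/-- The truncated projections of `x` onto sets that carry almost all of its mass approximate `x`. -/
theorem norm_sub_truncatedProj_le (hk : ∀ w, J (k w) = Fock.kernelFun α p w) (x : X)
    {s : Set ℂ} (hs : MeasurableSet s) (hs' : volume s < ∞) :
    ‖((Real.pi / α : ℝ) : ℂ) • x - truncatedProj α k s (J x)‖ ≤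
      Fock.normFactor α p * (2 * Real.pi / α) *
        (eLpNorm (sᶜ.indicator (weighted α (J x))) p volume).toReal := by
  have hα' := hα.out
  have hπ := Real.pi_pos
  have h1 : ⇑(J (((Real.pi / α : ℝ) : ℂ) • x - truncatedProj α k s (J x))) =
      fun u => ∫ z in sᶜ, J x z * kernel α u z * (Real.exp (-α * ‖z‖ ^ 2) : ℂ) := by
    ext u
    rw [map_sub, map_smul]
    change ((Real.pi / α : ℝ) : ℂ) * J x u - J (truncatedProj α k s (J x)) u = _
    rw [coe_truncatedProj J hk (J x) hs']
    have h2 := (J x).integral_mul_kernel u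
    rw [← integral_add_compl hs ((J x).integrable_mul_kernel u)] at h2
    rw [Complex.ofReal_div, ← h2, add_sub_cancel_left]
  have h3 : eLpNorm (weighted α ⇑(J (((Real.pi / α : ℝ) : ℂ) • x - truncatedProj α k s (J x))))
      p volume ≤ ENNReal.ofReal (2 * Real.pi / α) *
        eLpNorm (sᶜ.indicator (weighted α (J x))) p volume := by
    rw [h1]
    exact eLpNorm_weighted_setIntegral_kernel_le hα' hp.out (J x).differentiable.continuous hs.compl
  have h4 := Fock.norm_le_of_eLpNorm_le (ENNReal.mul_lt_top ENNReal.ofReal_lt_top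
    ((J x).memLp.indicator hs.compl).2).ne h3
  rw [J.norm_map, ENNReal.toReal_mul, ENNReal.toReal_ofReal (by positivity)] at h4
  rwa [mul_assoc]

/-- If the mass of every element of `X` is concentrated on sets of finite area, then the kernel
functions span a dense subspace: a bounded operator that vanishes on them is zero. -/
theorem eq_zero_of_forall_kernel (hk : ∀ w, J (k w) = Fock.kernelFun α p w)
    (htight : ∀ x : X, ∀ ε : ℝ≥0∞, ε ≠ 0 → ∃ s : Set ℂ, MeasurableSet s ∧ volume s < ∞ ∧
      eLpNorm (sᶜ.indicator (weighted α (J x))) p volume ≤ ε)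
    {Y : Type*} [NormedAddCommGroup Y] [NormedSpace ℂ Y] [CompleteSpace Y] (D : X →L[ℂ] Y)
    (hD : ∀ w, D (k w) = 0) : D = 0 := by
  have hα' := hα.out
  have hπ := Real.pi_pos
  ext x
  have h1 : ∀ s : Set ℂ, volume s < ∞ → D (truncatedProj α k s (J x)) = 0 := by
    intro s hs
    rw [truncatedProj, ← D.integral_comp_comm (integrableOn_truncatedProj J hk (J x) hs)]
    simp [hD]
  set c := ‖D‖ * (Fock.normFactor α p * (2 * Real.pi / α)) with hc
  have hc0 : 0 ≤ c := by
    have := (Fock.normFactor_pos (α := α) (p := p)).le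
    positivity
  have h2 : ‖D (((Real.pi / α : ℝ) : ℂ) • x)‖ ≤ 0 := by
    refine le_of_forall_pos_le_add fun ε hε => ?_
    obtain ⟨s, hs, hs', hsε⟩ := htight x (ENNReal.ofReal (ε / (c + 1)))
      (by simpa using by positivity)
    have h3 := D.le_opNorm (((Real.pi / α : ℝ) : ℂ) • x - truncatedProj α k s (J x))
    rw [map_sub, h1 s hs', sub_zero] at h3
    have h4 : (eLpNorm (sᶜ.indicator (weighted α (J x))) p volume).toReal ≤ ε / (c + 1) := by
      have := ENNReal.toReal_mono ENNReal.ofReal_ne_top hsε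
      rwa [ENNReal.toReal_ofReal (by positivity)] at this
    calc ‖D (((Real.pi / α : ℝ) : ℂ) • x)‖
        ≤ ‖D‖ * (Fock.normFactor α p * (2 * Real.pi / α) *
          (eLpNorm (sᶜ.indicator (weighted α (J x))) p volume).toReal) :=
          h3.trans (mul_le_mul_of_nonneg_left (norm_sub_truncatedProj_le J hk x hs hs')
            (norm_nonneg _))
      _ = c * (eLpNorm (sᶜ.indicator (weighted α (J x))) p volume).toReal := by
          rw [hc]
          ring
      _ ≤ (c + 1) * (ε / (c + 1)) := by gcongr; linarith
      _ = 0 + ε := by field_simp; ring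
  have h5 : D (((Real.pi / α : ℝ) : ℂ) • x) = 0 := norm_le_zero_iff.1 h2
  rw [map_smul, smul_eq_zero] at h5
  refine h5.resolve_left ?_
  exact Complex.ofReal_ne_zero.2 (by positivity)

end Subspace

/-! ### Integrals of rank one operators -/

section NuclearIntegral

/-- A bounded continuous function on a separable space is a sum of functions with countably many
values whose suprema are summable. -/
theorem exists_hasSum_countable_valued {Ω Y : Type*} [TopologicalSpace Ω]
    [TopologicalSpace.SeparableSpace Ω] [MeasurableSpace Ω] [OpensMeasurableSpace Ω] [Nonempty Ω]
    [NormedAddCommGroup Y] [CompleteSpace Y] {y : Ω → Y} (hy : Continuous y) {B : ℝ}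
    (hB : ∀ w, ‖y w‖ ≤ B) :
    ∃ (ι : ℕ → Ω → ℕ) (v : ℕ → ℕ → Y) (b : ℕ → ℝ), (∀ k, Measurable (ι k)) ∧
      (∀ k w, ‖v k (ι k w)‖ ≤ b k) ∧ (∀ w, HasSum (fun k => v k (ι k w)) (y w)) ∧
      HasSum b (B + 3) := by
  classical
  let d := TopologicalSpace.denseSeq Ω
  have hex : ∀ (k : ℕ) (w : Ω), ∃ i, ‖y w - y (d i)‖ < (1 / 2) ^ k := by
    intro k w
    have ho : IsOpen {w' | ‖y w - y w'‖ < (1 / 2) ^ k} :=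
      isOpen_lt (by fun_prop) continuous_const
    obtain ⟨_, hw', i, rfl⟩ := (TopologicalSpace.denseRange_denseSeq Ω).inter_open_nonempty _ ho
      ⟨w, by simp⟩
    exact ⟨i, hw'⟩
  let n : ℕ → Ω → ℕ := fun k w => Nat.find (hex k w)
  have hn : ∀ k w, ‖y w - y (d (n k w))‖ < (1 / 2) ^ k := fun k w => Nat.find_spec (hex k w)
  have hnm : ∀ k, Measurable (n k) := fun k => measurable_find (hex k) fun i =>
    (isOpen_lt (by fun_prop) continuous_const).measurableSet
  let ι : ℕ → Ω → ℕ := fun k => Nat.casesOn k (n 0) fun k w => Nat.pair (n (k + 1) w) (n k w)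
  let v : ℕ → ℕ → Y := fun k => Nat.casesOn k (fun i => y (d i)) fun _ m =>
    y (d m.unpair.1) - y (d m.unpair.2)
  let b : ℕ → ℝ := fun k => Nat.casesOn k B fun k => 3 / 2 * (1 / 2) ^ k
  have hv : ∀ k w, v (k + 1) (ι (k + 1) w) = y (d (n (k + 1) w)) - y (d (n k w)) := by
    intro k w
    simp [v, ι]
  have hb : HasSum b (B + 3) := by
    have h1 : HasSum (fun k => b (k + 1)) 3 := by
      have := (hasSum_geometric_two).mul_left (3 / 2)
      rwa [show (3 / 2 : ℝ) * 2 = 3 by norm_num] at this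
    rw [add_comm]
    have h2 := (hasSum_nat_add_iff 1).1 h1
    rwa [Finset.sum_range_one] at h2
  have hvb : ∀ k w, ‖v k (ι k w)‖ ≤ b k := by
    intro k w
    cases k with
    | zero => exact hB _
    | succ k =>
      rw [hv]
      have h1 := (hn (k + 1) w).le
      have h2 := (hn k w).le
      have h3 : y (d (n (k + 1) w)) - y (d (n k w)) =
        (y w - y (d (n k w))) - (y w - y (d (n (k + 1) w))) := by abel
      rw [h3]
      refine (norm_sub_le _ _).trans ?_
      change _ ≤ 3 / 2 * (1 / 2 : ℝ) ^ k
      rw [pow_succ] at h1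
      linarith
  refine ⟨ι, v, b, fun k => ?_, hvb, fun w => ?_, hb⟩
  · cases k with
    | zero => exact hnm 0
    | succ k =>
      have : Measurable fun x : ℕ × ℕ => Nat.pair x.1 x.2 := measurable_of_countable _
      exact this.comp ((hnm (k + 1)).prodMk (hnm k))
  · have hs : Summable fun k => v k (ι k w) := hb.summable.of_norm_bounded fun k => hvb k w
    rw [hs.hasSum_iff_tendsto_nat, ← tendsto_add_atTop_iff_nat 1]
    have h1 : ∀ m, ∑ k ∈ Finset.range (m + 1), v k (ι k w) = y (d (n m w)) := by
      intro m
      induction m with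
      | zero => simp [v, ι]
      | succ m ih => rw [Finset.sum_range_succ, ih, hv]; abel
    simp only [h1]
    rw [tendsto_iff_norm_sub_tendsto_zero]
    refine squeeze_zero (fun _ => norm_nonneg _) (fun m => ?_)
      (tendsto_pow_atTop_nhds_zero_of_lt_one (r := (1 / 2 : ℝ)) (by norm_num) (by norm_num))
    rw [norm_sub_rev]
    exact (hn m w).le

variable {Ω X Y : Type*} [MeasurableSpace Ω] [NormedAddCommGroup X] [NormedSpace ℂ X]
  [NormedAddCommGroup Y] [NormedSpace ℂ Y]

theorem norm_setIntegral_apply_le (μ : Measure Ω) [IsFiniteMeasure μ] {φ : Ω → X →L[ℂ] ℂ}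
    {A : ℝ} (hA : ∀ w, ‖φ w‖ ≤ A) (E : Set Ω) (x : X) :
    ‖∫ w in E, φ w x ∂μ‖ ≤ A * μ.real E * ‖x‖ := by
  refine (norm_setIntegral_le_of_norm_le_const (measure_lt_top μ E) fun w _ =>
    (φ w).le_of_opNorm_le (hA w) x).trans_eq ?_
  ring

/-- The weak integral over `E` of a bounded weakly measurable family of functionals. -/
def weakSetIntegral (μ : Measure Ω) [IsFiniteMeasure μ] (φ : Ω → X →L[ℂ] ℂ)
    (hφ : ∀ x, Measurable fun w => φ w x) {A : ℝ} (hA : ∀ w, ‖φ w‖ ≤ A) (E : Set Ω) :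
    X →L[ℂ] ℂ :=
  have hi : ∀ x, IntegrableOn (fun w => φ w x) E μ := fun x =>
    Measure.integrableOn_of_bounded (measure_ne_top μ E) (hφ x).aestronglyMeasurable
      (ae_of_all _ fun w => (φ w).le_of_opNorm_le (hA w) x)
  LinearMap.mkContinuous
    { toFun := fun x => ∫ w in E, φ w x ∂μ
      map_add' := fun x x' => by
        simp only [map_add]
        exact integral_add (hi x) (hi x')
      map_smul' := fun c x => by
        simp only [map_smul]
        exact integral_smul c _ }
    (A * μ.real E) (norm_setIntegral_apply_le μ hA E)

/-- The integral `∫ φ(w) ⊗ y(w) dμ(w)` of a bounded family of rank one operators over a finite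
measure is nuclear, with nuclear norm bounded by the total mass. Writing `y` as a sum of functions
with countably many values, the integral becomes a series of rank one operators. -/
theorem exists_isNuclearRep_integral [TopologicalSpace Ω] [TopologicalSpace.SeparableSpace Ω]
    [OpensMeasurableSpace Ω] [Nonempty Ω] [CompleteSpace Y] (μ : Measure Ω) [IsFiniteMeasure μ]
    {φ : Ω → X →L[ℂ] ℂ} (hφ : ∀ x, Measurable fun w => φ w x) {A : ℝ} (hA : ∀ w, ‖φ w‖ ≤ A)
    {y : Ω → Y} (hy : Continuous y) {B : ℝ} (hB : ∀ w, ‖y w‖ ≤ B) :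
    ∃ (T : X →L[ℂ] Y) (φ' : ℕ → (X →L[ℂ] ℂ)) (y' : ℕ → Y), IsNuclearRep T φ' y' ∧
      (∀ x, T x = ∫ w, φ w x • y w ∂μ) ∧
      ∑' j, ‖φ' j‖ₑ * ‖y' j‖ₑ ≤ ENNReal.ofReal (A * (B + 3)) * μ Set.univ := by
  obtain ⟨ι, v, b, hι, hvb, hsum, hb⟩ := exists_hasSum_countable_valued hy hB
  have hA0 : 0 ≤ A := (norm_nonneg _).trans (hA (Classical.arbitrary Ω))
  have hb0 : ∀ k, 0 ≤ b k := fun k => (norm_nonneg _).trans (hvb k (Classical.arbitrary Ω))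
  let E : ℕ × ℕ → Set Ω := fun j => ι j.1 ⁻¹' {j.2}
  have hE : ∀ j, MeasurableSet (E j) := fun j => hι j.1 (measurableSet_singleton _)
  have hEv : ∀ j, ∀ w ∈ E j, ‖v j.1 j.2‖ ≤ b j.1 := by
    rintro ⟨k, i⟩ w hw
    have : ι k w = i := hw
    simpa [this] using hvb k w
  obtain ⟨ψ, hψx, hψ⟩ : ∃ ψ : ℕ × ℕ → (X →L[ℂ] ℂ), (∀ j x, ψ j x = ∫ w in E j, φ w x ∂μ) ∧
      ∀ j, ‖ψ j‖ ≤ A * μ.real (E j) :=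
    ⟨fun j => weakSetIntegral μ φ hφ hA (E j), fun _ _ => rfl, fun j =>
      LinearMap.mkContinuous_norm_le _ (by positivity) (norm_setIntegral_apply_le μ hA (E j))⟩
  have hbound : ∀ j, μ.real (E j) * ‖v j.1 j.2‖ ≤ μ.real (E j) * b j.1 := by
    intro j
    rcases (E j).eq_empty_or_nonempty with h | ⟨w, hw⟩
    · simp [h]
    · exact mul_le_mul_of_nonneg_left (hEv j w hw) (by positivity)
  have hmass : ∀ k, ∑' i, μ (E (k, i)) = μ Set.univ := by
    intro k
    rw [← measure_iUnion (fun i i' hne => ?_) fun i => hE (k, i)]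
    · congr 1
      ext w
      simp [E]
    · exact (Set.disjoint_singleton.2 hne).preimage _
  -- the total mass of the majorant, computed along each of the partitions
  have htotal : ∑' j : ℕ × ℕ, ENNReal.ofReal (A * (μ.real (E j) * b j.1)) ≤
      ENNReal.ofReal (A * (B + 3)) * μ Set.univ := by
    have h1 : ∀ j : ℕ × ℕ, ENNReal.ofReal (A * (μ.real (E j) * b j.1)) =
        ENNReal.ofReal (A * b j.1) * μ (E j) := by
      intro j
      rw [mul_left_comm, mul_comm, ENNReal.ofReal_mul (mul_nonneg hA0 (hb0 _)),
        ofReal_measureReal]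
    simp_rw [h1]
    rw [ENNReal.tsum_prod (f := fun k i => ENNReal.ofReal (A * b k) * μ (E (k, i)))]
    simp_rw [ENNReal.tsum_mul_left, hmass]
    rw [ENNReal.tsum_mul_right, ← ENNReal.ofReal_tsum_of_nonneg
      (fun k => mul_nonneg hA0 (hb0 k)) (hb.summable.mul_left A), (hb.mul_left A).tsum_eq]
  have hmaj : Summable fun j : ℕ × ℕ => A * (μ.real (E j) * b j.1) := by
    have h1 : ∑' j : ℕ × ℕ, ENNReal.ofReal (A * (μ.real (E j) * b j.1)) ≠ ∞ :=
      ne_top_of_le_ne_top (ENNReal.mul_ne_top ENNReal.ofReal_ne_top (measure_ne_top _ _)) htotal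
    have h2 := ENNReal.summable_toReal h1
    refine h2.congr fun j => ENNReal.toReal_ofReal ?_
    have := hb0 j.1
    positivity
  have hterm : ∀ j, ‖ψ j‖ * ‖v j.1 j.2‖ ≤ A * (μ.real (E j) * b j.1) := fun j =>
    calc ‖ψ j‖ * ‖v j.1 j.2‖ ≤ A * μ.real (E j) * ‖v j.1 j.2‖ := by
          gcongr
          exact hψ j
      _ = A * (μ.real (E j) * ‖v j.1 j.2‖) := mul_assoc _ _ _
      _ ≤ _ := mul_le_mul_of_nonneg_left (hbound j) hA0
  have hnorm : Summable fun j : ℕ × ℕ => ‖ψ j‖ * ‖v j.1 j.2‖ :=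
    hmaj.of_nonneg_of_le (fun j => by positivity) hterm
  obtain ⟨T, hT⟩ : Summable fun j : ℕ × ℕ => ContinuousLinearMap.smulRight (ψ j) (v j.1 j.2) :=
    hnorm.of_norm_bounded fun j => (ContinuousLinearMap.norm_smulRight_apply _ _).le
  let e : ℕ ≃ ℕ × ℕ := Nat.pairEquiv.symm
  refine ⟨T, fun m => ψ (e m), fun m => v (e m).1 (e m).2, ⟨?_, ?_⟩, fun x => ?_, ?_⟩
  · exact e.summable_iff (f := fun j => ‖ψ j‖ * ‖v j.1 j.2‖) |>.2 hnorm
  · exact e.hasSum_iff (f := fun j => ContinuousLinearMap.smulRight (ψ j) (v j.1 j.2)) |>.2 hT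
  · have h1 : HasSum (fun j : ℕ × ℕ => ψ j x • v j.1 j.2) (T x) :=
      hT.mapL (ContinuousLinearMap.apply ℂ Y x)
    have hF : ∀ j : ℕ × ℕ, ∫ w, (E j).indicator (fun w => φ w x • v j.1 j.2) w ∂μ =
        ψ j x • v j.1 j.2 := by
      intro j
      rw [integral_indicator (hE j), integral_smul_const, hψx]
    have hFn : ∀ j : ℕ × ℕ, ∀ w, ‖(E j).indicator (fun w => φ w x • v j.1 j.2) w‖ ≤
        (E j).indicator (fun _ => A * ‖x‖ * b j.1) w := by
      intro j w
      by_cases hw : w ∈ E j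
      · rw [Set.indicator_of_mem hw, Set.indicator_of_mem hw, norm_smul]
        have h2 := hEv j w hw
        have h3 := (φ w).le_of_opNorm_le (hA w) x
        gcongr
      · simp [hw]
    have hFm : ∀ j : ℕ × ℕ,
        AEStronglyMeasurable ((E j).indicator fun w => φ w x • v j.1 j.2) μ := fun j =>
      ((hφ x).stronglyMeasurable.smul_const _).aestronglyMeasurable.indicator (hE j)
    have hgi : ∀ j : ℕ × ℕ, Integrable ((E j).indicator fun _ => A * ‖x‖ * b j.1) μ := fun j =>
      (integrable_const _).indicator (hE j)
    have hFi : ∀ j : ℕ × ℕ, Integrable ((E j).indicator fun w => φ w x • v j.1 j.2) μ := fun j =>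
      (hgi j).mono' (hFm j) (ae_of_all _ (hFn j))
    have hFs : Summable fun j : ℕ × ℕ =>
        ∫ w, ‖(E j).indicator (fun w => φ w x • v j.1 j.2) w‖ ∂μ := by
      refine (hmaj.mul_left ‖x‖).of_nonneg_of_le (fun j => integral_nonneg fun w => norm_nonneg _)
        fun j => (integral_mono (hFi j).norm (hgi j) (hFn j)).trans_eq ?_
      rw [integral_indicator (hE j), setIntegral_const, smul_eq_mul]
      ring
    have h4 := hasSum_integral_of_summable_integral_norm hFi hFs
    simp only [hF] at h4
    rw [h1.unique h4]
    refine integral_congr_ae (ae_of_all _ fun w => HasSum.tsum_eq ?_)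
    -- at `w`, only the pairs `(k, ι k w)` contribute
    have hinj : Function.Injective fun k : ℕ => (k, ι k w) := fun k k' h => (Prod.ext_iff.1 h).1
    refine (hinj.hasSum_iff ?_).1 ?_
    · rintro ⟨k, i⟩ hki
      refine Set.indicator_of_notMem (fun hw => hki ⟨k, ?_⟩) _
      have : ι k w = i := hw
      simp [this]
    · convert (hsum w).const_smul (φ w x) using 2 with k
      exact Set.indicator_of_mem (show w ∈ E (k, ι k w) from rfl)
        fun w' => φ w' x • v k (ι k w)
  · rw [e.tsum_eq fun j => ‖ψ j‖ₑ * ‖v j.1 j.2‖ₑ]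
    refine (ENNReal.tsum_le_tsum fun j => ?_).trans htotal
    rw [← ofReal_norm, ← ofReal_norm, ← ENNReal.ofReal_mul (norm_nonneg _)]
    exact ENNReal.ofReal_le_ofReal (hterm j)

end NuclearIntegral

/-! ### Inclusions between Fock spaces -/

/-- Interpolation between `L^q` and `L^∞`, in a form that is convenient for functions whose two
norms are both controlled by the same quantity. -/
theorem eLpNorm_le_of_enorm_le {p q : ℝ≥0∞} (hq : q ≠ 0) (hqp : q ≤ p) {g : ℂ → ℂ}
    (hm : Measurable g) {D : ℝ≥0∞} (hg : ∀ z, ‖g z‖ₑ ≤ D) (hgq : eLpNorm g q volume ≤ D) :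
    eLpNorm g p volume ≤ D := by
  rcases eq_or_ne p ∞ with rfl | hp
  · exact eLpNormEssSup_le_of_ae_enorm_bound (ae_of_all _ hg)
  have hp0 : p ≠ 0 := (pos_iff_ne_zero.2 hq |>.trans_le hqp).ne'
  have hq' : q ≠ ∞ := ne_top_of_le_ne_top hp hqp
  have hpr : 0 < p.toReal := ENNReal.toReal_pos hp0 hp
  have hqr : 0 < q.toReal := ENNReal.toReal_pos hq hq'
  have hle : 0 ≤ p.toReal - q.toReal := sub_nonneg.2 (ENNReal.toReal_mono hp hqp)
  rw [eLpNorm_eq_lintegral_rpow_enorm_toReal hq hq', one_div, ENNReal.rpow_inv_le_iff hqr] at hgq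
  rw [eLpNorm_eq_lintegral_rpow_enorm_toReal hp0 hp, one_div, ENNReal.rpow_inv_le_iff hpr]
  have hsplit : ∀ a : ℝ≥0∞, a ^ p.toReal = a ^ (p.toReal - q.toReal) * a ^ q.toReal := fun a => by
    rw [← ENNReal.rpow_add_of_nonneg _ _ hle hqr.le, sub_add_cancel]
  calc ∫⁻ z, ‖g z‖ₑ ^ p.toReal
      ≤ ∫⁻ z, D ^ (p.toReal - q.toReal) * ‖g z‖ₑ ^ q.toReal := by
        refine lintegral_mono fun z => ?_
        rw [hsplit]
        gcongr
        exact hg z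
    _ = D ^ (p.toReal - q.toReal) * ∫⁻ z, ‖g z‖ₑ ^ q.toReal :=
        lintegral_const_mul _ (hm.enorm.pow_const _)
    _ ≤ D ^ (p.toReal - q.toReal) * D ^ q.toReal := by gcongr
    _ = D ^ p.toReal := (hsplit D).symm

namespace Fock

variable {α : ℝ} [hα : Fact (0 < α)] {p q : ℝ≥0∞} [hq : Fact (1 ≤ q)]

variable (α q) in
/-- A bound for the inclusions of `F^q_α` into the larger Fock spaces. -/
def inclBound : ℝ := evalBound α q + (normFactor α q)⁻¹

theorem inclBound_nonneg : 0 ≤ inclBound α q :=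
  add_nonneg evalBound_nonneg (inv_nonneg.2 normFactor_pos.le)

theorem eLpNorm_weighted_le (hqp : q ≤ p) (f : Fock α q) :
    eLpNorm (weighted α f) p volume ≤ ENNReal.ofReal (inclBound α q * ‖f‖) := by
  have h0 := inv_nonneg.2 (normFactor_pos (α := α) (p := q)).le
  have h0' := (normFactor_pos (α := α) (p := q)).ne'
  have h1 := evalBound_nonneg (α := α) (p := q)
  refine eLpNorm_le_of_enorm_le (zero_lt_one.trans_le hq.out).ne' hqp
    f.continuous_weighted.measurable (fun z => ?_) ?_
  · rw [← ofReal_norm]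
    refine ENNReal.ofReal_le_ofReal ((f.norm_weighted_le z).trans ?_)
    rw [inclBound]
    gcongr
    linarith
  · rw [← ENNReal.ofReal_toReal f.memLp.2.ne]
    refine ENNReal.ofReal_le_ofReal ?_
    have h2 : (eLpNorm (weighted α f) q volume).toReal = (normFactor α q)⁻¹ * ‖f‖ := by
      rw [norm_eq, inv_mul_cancel_left₀ h0']
    rw [h2, inclBound]
    gcongr
    linarith

theorem memLp_weighted_of_le (hqp : q ≤ p) (f : Fock α q) : MemLp (weighted α f) p volume :=
  ⟨f.continuous_weighted.aestronglyMeasurable,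
    (f.eLpNorm_weighted_le hqp).trans_lt ENNReal.ofReal_lt_top⟩

end Fock

/-! ### The Berezin transform and the lower bound for the nuclear norm -/

theorem norm_kernel_sq_mul (α : ℝ) (z w : ℂ) :
    ‖kernel α z w‖ ^ 2 * Real.exp (-α * ‖w‖ ^ 2) * Real.exp (-α * ‖z‖ ^ 2) =
      Real.exp (-α * ‖w - z‖ ^ 2) := by
  rw [norm_kernel, ← Real.exp_nat_mul, ← Real.exp_add, ← Real.exp_add, norm_sub_rev w z]
  congr 1
  push_cast
  ring

theorem Admissible.sigmaFinite {α : ℝ} (hα : 0 < α) {μ : Measure ℂ} (hμ : Admissible α μ) :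
    SigmaFinite μ := by
  have h1 : ∀ R : ℝ, μ (Metric.ball 0 R) < ∞ := by
    intro R
    have h2 := hμ 0
    have h3 : Metric.ball (0 : ℂ) R ⊆ {w | ENNReal.ofReal (Real.exp (-α * R ^ 2)) ≤
        ENNReal.ofReal (‖kernel α 0 w‖ ^ 2 * Real.exp (-α * ‖w‖ ^ 2))} := by
      intro w hw
      have hw' : ‖w‖ < R := by simpa using hw
      refine ENNReal.ofReal_le_ofReal ?_
      simp only [kernel, mul_zero, zero_mul, Complex.exp_zero, norm_one, one_pow, one_mul]
      refine Real.exp_le_exp.2 ?_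
      have : ‖w‖ ^ 2 ≤ R ^ 2 := by gcongr
      nlinarith
    refine (measure_mono h3).trans_lt
      ((meas_ge_le_lintegral_div ?_ ?_ ENNReal.ofReal_ne_top).trans_lt
      (ENNReal.div_lt_top h2.ne ?_))
    · have : Measurable fun w => kernel α 0 w :=
        ((continuous_kernel α).comp (continuous_const.prodMk continuous_id)).measurable
      fun_prop
    · simpa using Real.exp_pos _
    · simpa using Real.exp_pos _
  have : IsLocallyFiniteMeasure μ :=
    ⟨fun z => ⟨Metric.ball 0 (‖z‖ + 1), Metric.isOpen_ball.mem_nhds (by simp), h1 _⟩⟩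
  infer_instance

/-- `(T_μ K_z)(z) exp (-α |z|²)` is, up to a factor, the integral of the translated Gaussian. -/
theorem toeplitz_kernel_mul {α : ℝ} {μ : Measure ℂ} (hμ : Admissible α μ) (z : ℂ) :
    ∫⁻ w, ENNReal.ofReal (Real.exp (-α * ‖w - z‖ ^ 2)) ∂μ ≠ ∞ ∧
    toeplitz α μ (fun u => kernel α u z) z * (Real.exp (-α * ‖z‖ ^ 2) : ℂ) =
      ((α / Real.pi *
        (∫⁻ w, ENNReal.ofReal (Real.exp (-α * ‖w - z‖ ^ 2)) ∂μ).toReal : ℝ) : ℂ) := by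
  have hk : Continuous fun w => kernel α z w :=
    (continuous_kernel α).comp (continuous_const.prodMk continuous_id)
  have h1 : ∀ w, kernel α z w * kernel α w z * (Real.exp (-α * ‖w‖ ^ 2) : ℂ) =
      ((‖kernel α z w‖ ^ 2 * Real.exp (-α * ‖w‖ ^ 2) : ℝ) : ℂ) := by
    intro w
    have h2 : kernel α w z = conj (kernel α z w) := by
      simp only [kernel, ← Complex.exp_conj, map_mul, Complex.conj_ofReal, Complex.conj_conj]
      congr 1
      ring
    rw [h2, Complex.mul_conj']
    push_cast
    ring
  have h3 : ∫⁻ w, ENNReal.ofReal (Real.exp (-α * ‖w - z‖ ^ 2)) ∂μ =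
      (∫⁻ w, ENNReal.ofReal (‖kernel α z w‖ ^ 2 * Real.exp (-α * ‖w‖ ^ 2)) ∂μ) *
        ENNReal.ofReal (Real.exp (-α * ‖z‖ ^ 2)) := by
    rw [← lintegral_mul_const _ (by fun_prop)]
    refine lintegral_congr fun w => ?_
    rw [← ENNReal.ofReal_mul (by positivity), norm_kernel_sq_mul]
  refine ⟨?_, ?_⟩
  · rw [h3]
    exact ENNReal.mul_ne_top (hμ z).ne ENNReal.ofReal_ne_top
  · rw [toeplitz]
    simp_rw [h1]
    rw [integral_complex_ofReal, h3, ENNReal.toReal_mul, ENNReal.toReal_ofReal (Real.exp_pos _).le,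
      integral_eq_lintegral_of_nonneg_ae (ae_of_all _ fun w => by positivity)
        (Continuous.aestronglyMeasurable (by fun_prop))]
    push_cast
    ring

section LowerBound

variable {α : ℝ} [hα : Fact (0 < α)] {p q : ℝ≥0∞} [hp : Fact (1 ≤ p)] [hq : Fact (1 ≤ q)]
  {X : Type*} [NormedAddCommGroup X] [NormedSpace ℂ X] [CompleteSpace X]
  (J : X →ₗᵢ[ℂ] Fock α p) {k : ℂ → X}

variable (α p q) in
/-- The constant in the lower bound for the nuclear norm. -/
def traceBound : ℝ := Fock.normFactor α p * (2 * Real.pi / α) * Fock.inclBound α q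

omit [CompleteSpace X] hp in
theorem traceBound_nonneg [Fact (1 ≤ p)] : 0 ≤ traceBound α p q := by
  have h1 := (Fock.normFactor_pos (α := α) (p := p)).le
  have h2 := Fock.inclBound_nonneg (α := α) (q := q)
  have h3 := hα.out.le
  have h4 := Real.pi_pos.le
  unfold traceBound
  positivity

/-- Integrating the diagonal of a nuclear operator over a set of finite area. Each rank one term
`φ ⊗ y` contributes the value of `φ` at a truncated projection of `y`. -/
theorem setLIntegral_gaussian_le (hk : ∀ w, J (k w) = Fock.kernelFun α p w) (hqp : q ≤ p)
    {μ : Measure ℂ} [SFinite μ] (hμ : Admissible α μ) {T : X →L[ℂ] Fock α q}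
    (hT : ∀ z, ⇑(T (k z)) = toeplitz α μ fun u => kernel α u z)
    {φ : ℕ → (X →L[ℂ] ℂ)} {y : ℕ → Fock α q} (hrep : IsNuclearRep T φ y)
    {s : Set ℂ} (hs : MeasurableSet s) (hs' : volume s < ∞) :
    ∫⁻ z in s, ∫⁻ w, ENNReal.ofReal (Real.exp (-α * ‖w - z‖ ^ 2)) ∂μ ≤
      ENNReal.ofReal (Real.pi / α * (traceBound α p q * ∑' j, ‖φ j‖ * ‖y j‖)) := by
  have hα' := hα.out
  have hπ := Real.pi_pos
  obtain ⟨hsum, hrep⟩ := hrep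
  set L : ℂ → ℝ≥0∞ := fun z => ∫⁻ w, ENNReal.ofReal (Real.exp (-α * ‖w - z‖ ^ 2)) ∂μ with hL
  have hLm : Measurable L := by
    have : Measurable (Function.uncurry fun z w : ℂ =>
        ENNReal.ofReal (Real.exp (-α * ‖w - z‖ ^ 2))) := by
      unfold Function.uncurry
      fun_prop
    exact this.lintegral_prod_right
  have hLf : ∀ z, L z ≠ ∞ := fun z => (toeplitz_kernel_mul hμ z).1
  let G : ℕ → ℂ → ℂ := fun j z => φ j ((y j z * (Real.exp (-α * ‖z‖ ^ 2) : ℂ)) • k z)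
  have hGsum : ∀ z, HasSum (fun j => G j z) ((α / Real.pi * (L z).toReal : ℝ) : ℂ) := by
    intro z
    have h1 : HasSum (fun j => (φ j (k z)) * y j z) (T (k z) z) :=
      (hrep.mapL (ContinuousLinearMap.apply ℂ (Fock α q) (k z))).mapL (Fock.evalCLM z)
    rw [hT] at h1
    have h2 := h1.mul_right (Real.exp (-α * ‖z‖ ^ 2) : ℂ)
    rw [(toeplitz_kernel_mul hμ z).2] at h2
    have h3 : ∀ j, G j z = φ j (k z) * y j z * (Real.exp (-α * ‖z‖ ^ 2) : ℂ) := fun j => by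
      change φ j (_ • k z) = _
      rw [map_smul, smul_eq_mul]
      ring
    simp only [h3]
    exact h2
  set c := Fock.evalBound α q * Fock.kernelBound α p with hc
  have hGle : ∀ j z, ‖G j z‖ ≤ c * (‖φ j‖ * ‖y j‖) := by
    intro j z
    refine (φ j).le_opNorm _ |>.trans ?_
    refine (mul_le_mul_of_nonneg_left (norm_truncatedProj_integrand_le J hk (y j) z)
      (norm_nonneg _)).trans_eq ?_
    rw [hc]
    ring
  have hGi : ∀ j, IntegrableOn (G j) s := fun j =>
    (φ j).integrable_comp (integrableOn_truncatedProj J hk (y j) hs')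
  have hGint : ∀ j, ∫ z in s, G j z = φ j (truncatedProj α k s (y j)) := fun j =>
    (φ j).integral_comp_comm (integrableOn_truncatedProj J hk (y j) hs')
  have hGtrace : ∀ j, ‖∫ z in s, G j z‖ ≤ traceBound α p q * (‖φ j‖ * ‖y j‖) := by
    intro j
    rw [hGint]
    refine (φ j).le_opNorm _ |>.trans ?_
    have h1 := norm_truncatedProj_le J hk (y j) ((y j).memLp_weighted_of_le hqp) hs hs'
    have h2 := ENNReal.toReal_mono ENNReal.ofReal_ne_top ((y j).eLpNorm_weighted_le hqp)
    rw [ENNReal.toReal_ofReal (mul_nonneg Fock.inclBound_nonneg (norm_nonneg _))] at h2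
    have h3 := (Fock.normFactor_pos (α := α) (p := p)).le
    calc ‖φ j‖ * ‖truncatedProj α k s (y j)‖
        ≤ ‖φ j‖ * (Fock.normFactor α p * (2 * Real.pi / α) *
            (Fock.inclBound α q * ‖y j‖)) := by
          refine mul_le_mul_of_nonneg_left (h1.trans ?_) (norm_nonneg _)
          gcongr
      _ = traceBound α p q * (‖φ j‖ * ‖y j‖) := by
          rw [traceBound]
          ring
  have : IsFiniteMeasure (volume.restrict s) := ⟨by simpa using hs'⟩
  have hGs : Summable fun j => ∫ z in s, ‖G j z‖ := by
    refine ((hsum.mul_left c).mul_left (volume.real s)).of_nonneg_of_le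
      (fun j => integral_nonneg fun z => norm_nonneg _) fun j => ?_
    refine (integral_mono (hGi j).norm (integrable_const _) (hGle j)).trans_eq ?_
    simp
  have hH := hasSum_integral_of_summable_integral_norm hGi hGs
  simp only [(hGsum _).tsum_eq] at hH
  rw [integral_complex_ofReal, integral_const_mul] at hH
  have hHn : ‖((α / Real.pi * ∫ z in s, (L z).toReal : ℝ) : ℂ)‖ ≤
      traceBound α p q * ∑' j, ‖φ j‖ * ‖y j‖ := by
    rw [← hH.tsum_eq, ← tsum_mul_left]
    exact tsum_of_norm_bounded (hsum.mul_left _).hasSum hGtrace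
  have hI0 : 0 ≤ ∫ z in s, (L z).toReal := integral_nonneg fun z => ENNReal.toReal_nonneg
  rw [Complex.norm_real, Real.norm_of_nonneg (by positivity)] at hHn
  have hLi : IntegrableOn (fun z => (L z).toReal) s := by
    refine Measure.integrableOn_of_bounded hs'.ne hLm.ennreal_toReal.aestronglyMeasurable
      (M := Real.pi / α * ∑' j, c * (‖φ j‖ * ‖y j‖)) (ae_of_all _ fun z => ?_)
    have h1 := tsum_of_norm_bounded (hsum.mul_left c).hasSum fun j => hGle j z
    rw [(hGsum z).tsum_eq, Complex.norm_real, norm_mul,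
      Real.norm_of_nonneg (div_pos hα' hπ).le, div_mul_eq_mul_div, div_le_iff₀ hπ] at h1
    rw [div_mul_eq_mul_div, le_div_iff₀ hα']
    linarith
  calc ∫⁻ z in s, L z = ∫⁻ z in s, ENNReal.ofReal (L z).toReal :=
        lintegral_congr fun z => (ENNReal.ofReal_toReal (hLf z)).symm
    _ = ENNReal.ofReal (∫ z in s, (L z).toReal) :=
        (ofReal_integral_eq_lintegral_ofReal hLi (ae_of_all _ fun z => ENNReal.toReal_nonneg)).symm
    _ ≤ _ := by
        refine ENNReal.ofReal_le_ofReal ?_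
        rw [div_mul_eq_mul_div, le_div_iff₀ hα']
        rw [div_mul_eq_mul_div, div_le_iff₀ hπ] at hHn
        linarith

/-- The lower bound for the nuclear norm: the Berezin transform of `μ` has total integral
`μ(ℂ)`. -/
theorem measure_univ_le_of_isNuclearRep (hk : ∀ w, J (k w) = Fock.kernelFun α p w) (hqp : q ≤ p)
    {μ : Measure ℂ} (hμ : Admissible α μ) {T : X →L[ℂ] Fock α q}
    (hT : ∀ z, ⇑(T (k z)) = toeplitz α μ fun u => kernel α u z)
    {φ : ℕ → (X →L[ℂ] ℂ)} {y : ℕ → Fock α q} (hrep : IsNuclearRep T φ y) :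
    μ Set.univ ≤ ENNReal.ofReal (traceBound α p q) * ∑' j, ‖φ j‖ₑ * ‖y j‖ₑ := by
  have hα' := hα.out
  have hπ := Real.pi_pos
  have := hμ.sigmaFinite hα'
  set S := ∑' j, ‖φ j‖ * ‖y j‖ with hS
  have h1 : ∫⁻ z, ∫⁻ w, ENNReal.ofReal (Real.exp (-α * ‖w - z‖ ^ 2)) ∂μ ≤
      ENNReal.ofReal (Real.pi / α * (traceBound α p q * S)) := by
    rw [← setLIntegral_univ, ← Metric.iUnion_ball_nat (0 : ℂ),
      setLIntegral_iUnion_of_directed _ (directed_of_isDirected_le fun m n hmn =>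
        Metric.ball_subset_ball (by exact_mod_cast hmn))]
    exact iSup_le fun n => setLIntegral_gaussian_le J hk hqp hμ hT hrep
      Metric.isOpen_ball.measurableSet measure_ball_lt_top
  have h2 : ∫⁻ z, ∫⁻ w, ENNReal.ofReal (Real.exp (-α * ‖w - z‖ ^ 2)) ∂μ =
      ENNReal.ofReal (Real.pi / α) * μ Set.univ := by
    rw [lintegral_lintegral_swap (Measurable.aemeasurable (by unfold Function.uncurry; fun_prop))]
    have h3 : ∀ w : ℂ, ∫⁻ z : ℂ, ENNReal.ofReal (Real.exp (-α * ‖w - z‖ ^ 2)) =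
        ENNReal.ofReal (Real.pi / α) := fun w => by
      rw [lintegral_sub_left_eq_self (fun z : ℂ => ENNReal.ofReal (Real.exp (-α * ‖z‖ ^ 2))) w,
        lintegral_gaussian hα']
    simp_rw [h3]
    simp
  have h4 : ENNReal.ofReal S = ∑' j, ‖φ j‖ₑ * ‖y j‖ₑ := by
    rw [hS, ENNReal.ofReal_tsum_of_nonneg (fun j => by positivity) hrep.1]
    refine tsum_congr fun j => ?_
    rw [ENNReal.ofReal_mul (norm_nonneg _), ofReal_norm, ofReal_norm]
  rw [h2, ENNReal.ofReal_mul (by positivity)] at h1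
  rw [← h4, ← ENNReal.ofReal_mul traceBound_nonneg]
  exact (ENNReal.mul_le_mul_iff_right (by simpa using by positivity) ENNReal.ofReal_ne_top).1 h1

end LowerBound

/-! ### Nuclearity of Toeplitz operators -/

section Main

theorem IsNuclearRep.nuclearNorm_le {X Y : Type*} [NormedAddCommGroup X] [NormedSpace ℂ X]
    [NormedAddCommGroup Y] [NormedSpace ℂ Y] {T : X →L[ℂ] Y} {φ : ℕ → (X →L[ℂ] ℂ)} {y : ℕ → Y}
    (h : IsNuclearRep T φ y) : nuclearNorm T ≤ ∑' j, ‖φ j‖ₑ * ‖y j‖ₑ := by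
  unfold nuclearNorm
  exact iInf_le_of_le φ (iInf_le_of_le y (iInf_le _ h))

variable {α : ℝ} [hα : Fact (0 < α)] {p q : ℝ≥0∞} [hp : Fact (1 ≤ p)] [hq : Fact (1 ≤ q)]
  {X : Type*} [NormedAddCommGroup X] [NormedSpace ℂ X] [CompleteSpace X]
  (J : X →ₗᵢ[ℂ] Fock α p) {k : ℂ → X}

variable (α p q) in
/-- The constant in the upper bound for the nuclear norm. -/
def integralBound : ℝ :=
  Fock.evalBound α p * (α / Real.pi * Fock.kernelBound α q + 3)

omit [CompleteSpace X] in
include J in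
/-- For finite `μ`, the operator `T_μ` is the integral over `μ` of the rank one operators
`f ↦ (α / π) f(w) exp (-α |w|²) K_w`. -/
theorem exists_toeplitz_of_isFiniteMeasure (μ : Measure ℂ) [IsFiniteMeasure μ] :
    ∃ (T : X →L[ℂ] Fock α q) (φ : ℕ → (X →L[ℂ] ℂ)) (y : ℕ → Fock α q),
      IsNuclearRep T φ y ∧ (∀ x, ⇑(T x) = toeplitz α μ (J x)) ∧
      ∑' j, ‖φ j‖ₑ * ‖y j‖ₑ ≤ ENNReal.ofReal (integralBound α p q) * μ Set.univ := by
  have hα' := hα.out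
  have hπ := Real.pi_pos
  let φ : ℂ → (X →L[ℂ] ℂ) := fun w =>
    ((Real.exp (-(α / 2) * ‖w‖ ^ 2) : ℝ) : ℂ) • (Fock.evalCLM w).comp J.toContinuousLinearMap
  let y : ℂ → Fock α q := fun w =>
    ((α / Real.pi * Real.exp (-(α / 2) * ‖w‖ ^ 2) : ℝ) : ℂ) • Fock.kernelFun α q w
  have hφx : ∀ w x, φ w x = weighted α (J x) w := fun w x => mul_comm _ _
  have hφc : ∀ x, Continuous fun w => φ w x := fun x => by
    simp only [hφx]
    exact (J x).continuous_weighted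
  have hφA : ∀ w, ‖φ w‖ ≤ Fock.evalBound α p := fun w =>
    ContinuousLinearMap.opNorm_le_bound _ Fock.evalBound_nonneg fun x => by
      rw [hφx, ← J.norm_map]
      exact (J x).norm_weighted_le w
  have hyc : Continuous y := by
    have := Fock.continuous_kernelFun (α := α) (p := q)
    fun_prop
  have hyB : ∀ w, ‖y w‖ ≤ α / Real.pi * Fock.kernelBound α q := fun w => by
    rw [norm_smul, Complex.norm_real, Real.norm_of_nonneg (by positivity)]
    refine (mul_le_mul_of_nonneg_left (Fock.norm_kernelFun_le w) (by positivity)).trans_eq ?_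
    have h : Real.exp (-(α / 2) * ‖w‖ ^ 2) * Real.exp (α / 2 * ‖w‖ ^ 2) = 1 := by
      rw [← Real.exp_add]
      simp
    calc _ = α / Real.pi * Fock.kernelBound α q *
          (Real.exp (-(α / 2) * ‖w‖ ^ 2) * Real.exp (α / 2 * ‖w‖ ^ 2)) := by ring
      _ = _ := by rw [h, mul_one]
  obtain ⟨T, φ', y', hrep, hTx, hle⟩ := exists_isNuclearRep_integral μ
    (fun x => (hφc x).measurable) hφA hyc hyB
  refine ⟨T, φ', y', hrep, fun x => ?_, hle⟩
  ext z
  have hint : Integrable (fun w => φ w x • y w) μ := by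
    rw [← integrableOn_univ]
    refine Measure.integrableOn_of_bounded (measure_ne_top μ _)
      (((hφc x).smul hyc).aestronglyMeasurable)
      (M := Fock.evalBound α p * ‖x‖ * (α / Real.pi * Fock.kernelBound α q))
      (ae_of_all _ fun w => ?_)
    rw [norm_smul]
    have h1 := (φ w).le_of_opNorm_le (hφA w) x
    exact mul_le_mul h1 (hyB w) (norm_nonneg _) ((norm_nonneg _).trans h1)
  change Fock.evalCLM z (T x) = _
  rw [hTx, ← (Fock.evalCLM z).integral_comp_comm hint, toeplitz, ← integral_const_mul]
  refine integral_congr_ae (ae_of_all _ fun w => ?_)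
  have h2 : (Real.exp (-α * ‖w‖ ^ 2) : ℂ) =
      (Real.exp (-(α / 2) * ‖w‖ ^ 2) : ℂ) * (Real.exp (-(α / 2) * ‖w‖ ^ 2) : ℂ) := by
    rw [← Complex.ofReal_mul, ← Real.exp_add]
    congr 2
    ring
  dsimp only
  rw [map_smul, map_smul, hφx, Fock.evalCLM_apply, Fock.coe_kernelFun, weighted, h2, smul_eq_mul,
    smul_eq_mul, Complex.ofReal_mul]
  ring

variable [FunLike X ℂ ℂ]

theorem kernel_mem_kernelSpan (α : ℝ) (w : ℂ) : (fun z => kernel α z w) ∈ kernelSpan α :=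
  Submodule.subset_span ⟨w, rfl⟩

/-- The characterization of nuclear Toeplitz operators on a space `X` that sits isometrically in
`F^p_α`, contains the kernel functions, and whose elements have most of their mass on sets of
finite area. -/
theorem exists_nuclearNorm_bounds (hJ : ∀ x, ⇑(J x) = ⇑x)
    (hk : ∀ w, J (k w) = Fock.kernelFun α p w)
    (htight : ∀ x : X, ∀ ε : ℝ≥0∞, ε ≠ 0 → ∃ s : Set ℂ, MeasurableSet s ∧ volume s < ∞ ∧
      eLpNorm (sᶜ.indicator (weighted α (J x))) p volume ≤ ε) (hqp : q ≤ p) :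
    ∃ c C : ℝ≥0, 0 < c ∧ 0 < C ∧ ∀ μ : Measure ℂ, Admissible α μ →
      (μ Set.univ < ∞ → ToeplitzNuclear X (Fock α q) α μ) ∧
      ∀ T : X →L[ℂ] Fock α q, IsToeplitz α μ T →
        c * μ Set.univ ≤ nuclearNorm T ∧ nuclearNorm T ≤ C * μ Set.univ := by
  -- the elements of the span of the kernel functions are represented in `X`
  have hspan : ∀ g ∈ kernelSpan α, ∃ x : X, ⇑x = g := by
    intro g hg
    induction hg using Submodule.span_induction with
    | mem g hg =>
      obtain ⟨w, rfl⟩ := hg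
      exact ⟨k w, by rw [← hJ, hk, Fock.coe_kernelFun]⟩
    | zero => exact ⟨0, by rw [← hJ, map_zero]; rfl⟩
    | add g h _ _ hg hh =>
      obtain ⟨x, rfl⟩ := hg
      obtain ⟨x', rfl⟩ := hh
      exact ⟨x + x', by rw [← hJ, map_add, Fock.coe_add, hJ, hJ]⟩
    | smul a g _ hg =>
      obtain ⟨x, rfl⟩ := hg
      exact ⟨a • x, by rw [← hJ, map_smul, Fock.coe_smul, hJ]⟩
  have hT : ∀ {μ : Measure ℂ} {T : X →L[ℂ] Fock α q}, IsToeplitz α μ T →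
      ∀ z, ⇑(T (k z)) = toeplitz α μ fun u => kernel α u z := by
    intro μ T hT z
    obtain ⟨f, hf, hTf⟩ := hT _ (kernel_mem_kernelSpan α z)
    have : f = k z := DFunLike.coe_injective (by rw [hf, ← hJ, hk, Fock.coe_kernelFun])
    rw [← this, hTf]
  -- the constants are enlarged to make them positive
  set t := (traceBound α p q + 1).toNNReal with ht
  have ht0 : 0 < t := Real.toNNReal_pos.2 (by
    have := traceBound_nonneg (α := α) (p := p) (q := q)
    linarith)
  refine ⟨t⁻¹, (|integralBound α p q| + 1).toNNReal, inv_pos.2 ht0,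
    Real.toNNReal_pos.2 (by positivity), fun μ hμ => ⟨fun hfin => ?_, fun T hTμ => ⟨?_, ?_⟩⟩⟩
  · have : IsFiniteMeasure μ := ⟨hfin⟩
    obtain ⟨T, φ, y, hrep, hTx, -⟩ := exists_toeplitz_of_isFiniteMeasure (q := q) J μ
    refine ⟨T, fun g hg => ?_, φ, y, hrep⟩
    obtain ⟨x, rfl⟩ := hspan g hg
    exact ⟨x, rfl, by rw [hTx, hJ]⟩
  · refine le_iInf fun φ => le_iInf fun y => le_iInf fun hrep => ?_
    rw [ENNReal.coe_inv ht0.ne', ENNReal.inv_mul_le_iff (by simpa using ht0.ne') ENNReal.coe_ne_top]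
    refine (measure_univ_le_of_isNuclearRep J hk hqp hμ (hT hTμ) hrep).trans ?_
    gcongr
    exact ENNReal.ofReal_le_ofReal (by linarith)
  · rcases eq_or_ne (μ Set.univ) ∞ with hfin | hfin
    · rw [hfin, ENNReal.mul_top]
      · exact le_top
      · simp only [ne_eq, ENNReal.coe_eq_zero, Real.toNNReal_eq_zero, not_le]
        positivity
    have : IsFiniteMeasure μ := ⟨hfin.lt_top⟩
    -- `T` agrees with the integral operator on the kernel functions, hence everywhere
    obtain ⟨T', φ, y, hrep, hTx, hle⟩ := exists_toeplitz_of_isFiniteMeasure (q := q) J μ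
    have hTT' : T - T' = 0 := eq_zero_of_forall_kernel J hk htight (T - T') fun w => by
      rw [sub_apply, sub_eq_zero]
      refine DFunLike.coe_injective ?_
      rw [hT hTμ, hTx, hk, Fock.coe_kernelFun]
    rw [← sub_eq_zero.1 hTT'] at hrep
    refine hrep.nuclearNorm_le.trans (hle.trans ?_)
    gcongr
    exact ENNReal.ofReal_le_ofReal ((le_abs_self _).trans (by linarith))

omit [CompleteSpace X] in
/-- A nuclear representation has finite total norm, so a lower bound for the nuclear norm in terms
of `μ(ℂ)` makes `μ` finite. -/
theorem measure_univ_lt_top_of_toeplitzNuclear {μ : Measure ℂ} {c : ℝ≥0} (hc : 0 < c)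
    (h : ∀ T : X →L[ℂ] Fock α q, IsToeplitz α μ T → c * μ Set.univ ≤ nuclearNorm T)
    (hμ : ToeplitzNuclear X (Fock α q) α μ) : μ Set.univ < ∞ := by
  obtain ⟨T, hT, φ, y, hrep⟩ := hμ
  have h1 := hrep.nuclearNorm_le
  have h2 : ∑' j, ‖φ j‖ₑ * ‖y j‖ₑ < ∞ := by
    have h3 := hrep.1.tsum_ofReal_lt_top
    simpa only [ENNReal.ofReal_mul (norm_nonneg _), ofReal_norm] using h3
  have h4 := ((h T hT).trans h1).trans_lt h2
  by_contra hne
  rw [not_lt, top_le_iff] at hne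
  rw [hne, ENNReal.mul_top (by simpa using hc.ne')] at h4
  exact lt_irrefl _ h4

end Main

/-! ### The two domains -/

theorem Fock.exists_nuclearNorm_bounds {α : ℝ} [Fact (0 < α)] {p q : ℝ≥0∞} [Fact (1 ≤ p)]
    [Fact (1 ≤ q)] (hqp : q ≤ p) (hp : p < ∞) :
    ∃ c C : ℝ≥0, 0 < c ∧ 0 < C ∧ ∀ μ : Measure ℂ, Admissible α μ →
      (μ Set.univ < ∞ → ToeplitzNuclear (Fock α p) (Fock α q) α μ) ∧
      ∀ T : Fock α p →L[ℂ] Fock α q, IsToeplitz α μ T →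
        c * μ Set.univ ≤ nuclearNorm T ∧ nuclearNorm T ≤ C * μ Set.univ := by
  refine FockToeplitz.exists_nuclearNorm_bounds (k := Fock.kernelFun α p) LinearIsometry.id
    (fun _ => rfl) (fun _ => rfl) (fun x ε hε => ?_) hqp
  obtain ⟨s, hs, hs', h⟩ := x.memLp.exists_eLpNorm_indicator_compl_lt hp.ne hε
  exact ⟨s, hs, hs', h.le⟩

theorem isClosed_fockVanishing (α : ℝ) [Fact (0 < α)] :
    IsClosed (fockVanishing α : Set (Fock α ∞)) := by
  rw [← isSeqClosed_iff_isClosed]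
  intro u f hu huf
  change Tendsto (weighted α f) (cocompact ℂ) (𝓝 0)
  refine TendstoUniformly.tendsto_of_eventually_tendsto (F := fun n => weighted α (u n))
    (L := fun _ => 0) (p := atTop) ?_ (.of_forall hu) tendsto_const_nhds
  rw [Metric.tendstoUniformly_iff]
  intro ε hε
  have h1 : Tendsto (fun n => Fock.evalBound α ∞ * ‖f - u n‖) atTop (𝓝 0) := by
    have h2 : Tendsto (fun n => ‖f - u n‖) atTop (𝓝 0) := by
      simpa using (tendsto_const_nhds (x := f)).sub huf |>.norm
    simpa using h2.const_mul (Fock.evalBound α ∞)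
  filter_upwards [h1.eventually_lt_const hε] with n hn z
  refine lt_of_le_of_lt ?_ hn
  rw [dist_eq_norm]
  refine Eq.trans_le ?_ ((f - u n).norm_weighted_le z)
  congr 1
  exact (sub_mul _ _ _).symm

instance (α : ℝ) [Fact (0 < α)] : CompleteSpace (fockVanishing α) :=
  (isClosed_fockVanishing α).completeSpace_coe

theorem kernelFun_mem_fockVanishing {α : ℝ} [hα : Fact (0 < α)] (w : ℂ) :
    Fock.kernelFun α ∞ w ∈ fockVanishing α := by
  change Tendsto (weighted α fun z => kernel α z w) (cocompact ℂ) (𝓝 0)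
  rw [tendsto_zero_iff_norm_tendsto_zero]
  simp only [norm_weighted_kernel]
  have h1 : Tendsto (fun z : ℂ => ‖z - w‖) (cocompact ℂ) atTop :=
    tendsto_norm_cocompact_atTop.comp (Homeomorph.subRight w).isClosedEmbedding.tendsto_cocompact
  have h2 : Tendsto (fun t : ℝ => Real.exp (-(α / 2) * t ^ 2)) atTop (𝓝 0) := by
    refine Real.tendsto_exp_atBot.comp ?_
    exact (tendsto_pow_atTop two_ne_zero).const_mul_atTop_of_neg (by linarith [hα.out])
  simpa using (h2.comp h1).const_mul (Real.exp (α / 2 * ‖w‖ ^ 2))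

theorem fockVanishing_exists_nuclearNorm_bounds {α : ℝ} [Fact (0 < α)] {s : ℝ≥0∞}
    [Fact (1 ≤ s)] :
    ∃ c C : ℝ≥0, 0 < c ∧ 0 < C ∧ ∀ μ : Measure ℂ, Admissible α μ →
      (μ Set.univ < ∞ → ToeplitzNuclear (fockVanishing α) (Fock α s) α μ) ∧
      ∀ T : fockVanishing α →L[ℂ] Fock α s, IsToeplitz α μ T →
        c * μ Set.univ ≤ nuclearNorm T ∧ nuclearNorm T ≤ C * μ Set.univ := by
  refine exists_nuclearNorm_bounds (p := ∞)
    (k := fun w => ⟨Fock.kernelFun α ∞ w, kernelFun_mem_fockVanishing w⟩)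
    (fockVanishing α).subtypeₗᵢ (fun _ => rfl) (fun _ => rfl) (fun x ε hε => ?_) le_top
  have hx : Tendsto (weighted α (x : Fock α ∞)) (cocompact ℂ) (𝓝 0) := x.2
  have h1 : ∀ᶠ z in cocompact ℂ, ‖weighted α (x : Fock α ∞) z‖ₑ < ε := by
    have h2 : Tendsto (fun z => ‖weighted α (x : Fock α ∞) z‖ₑ) (cocompact ℂ) (𝓝 0) := by
      simpa [Function.comp_def] using (continuous_enorm.tendsto (0 : ℂ)).comp hx
    exact h2.eventually_lt_const (pos_iff_ne_zero.2 hε)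
  obtain ⟨K, hK, hKε⟩ := mem_cocompact.1 h1
  refine ⟨K, hK.measurableSet, hK.measure_lt_top,
    eLpNormEssSup_le_of_ae_enorm_bound (ae_of_all _ fun z => ?_)⟩
  by_cases hz : z ∈ K
  · simp [hz]
  · rw [Set.indicator_of_mem (Set.mem_compl hz)]
    exact (hKε hz).le

end FockToeplitz

end

theorem theorem3p7 (α : ℝ) [Fact (0 < α)] (p q s : ℝ≥0∞)
    [Fact (1 ≤ p)] [Fact (1 ≤ q)] [Fact (1 ≤ s)] (hqp : q ≤ p) (hp : p < ∞) :
    (∀ μ : Measure ℂ, FockToeplitz.Admissible α μ →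
      [FockToeplitz.ToeplitzNuclear (FockToeplitz.Fock α p) (FockToeplitz.Fock α q) α μ,
       FockToeplitz.ToeplitzNuclear (FockToeplitz.fockVanishing α) (FockToeplitz.Fock α s) α μ,
       μ Set.univ < ∞].TFAE) ∧
    (∃ c C : ℝ≥0, 0 < c ∧ 0 < C ∧ ∀ μ : Measure ℂ, FockToeplitz.Admissible α μ →
      (∀ T : FockToeplitz.Fock α p →L[ℂ] FockToeplitz.Fock α q,
        FockToeplitz.IsToeplitz α μ T →
          c * μ Set.univ ≤ FockToeplitz.nuclearNorm T ∧
          FockToeplitz.nuclearNorm T ≤ C * μ Set.univ) ∧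
      (∀ T : FockToeplitz.fockVanishing α →L[ℂ] FockToeplitz.Fock α s,
        FockToeplitz.IsToeplitz α μ T →
          c * μ Set.univ ≤ FockToeplitz.nuclearNorm T ∧
          FockToeplitz.nuclearNorm T ≤ C * μ Set.univ)) ∧
    (∀ μ : Measure ℂ, FockToeplitz.Admissible α μ →
      FockToeplitz.ToeplitzNuclear (FockToeplitz.Fock α p) (FockToeplitz.Fock α q) α μ →
      ∀ (p' q' : ℝ≥0∞) [Fact (1 ≤ p')] [Fact (1 ≤ q')], q' ≤ p' → p' < ∞ →
        FockToeplitz.ToeplitzNuclear (FockToeplitz.Fock α p') (FockToeplitz.Fock α q') α μ) := by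
  obtain ⟨c, C, hc, hC, h⟩ := FockToeplitz.Fock.exists_nuclearNorm_bounds (α := α) hqp hp
  obtain ⟨c', C', hc', hC', h'⟩ :=
    FockToeplitz.fockVanishing_exists_nuclearNorm_bounds (α := α) (s := s)
  refine ⟨fun μ hμ => ?_, ⟨min c c', max C C', lt_min hc hc', lt_max_of_lt_left hC,
    fun μ hμ => ⟨fun T hT => ⟨?_, ?_⟩, fun T hT => ⟨?_, ?_⟩⟩⟩, fun μ hμ hn p' q' _ _ hqp' hp' => ?_⟩
  · tfae_have 1 → 3 := FockToeplitz.measure_univ_lt_top_of_toeplitzNuclear hc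
      fun T hT => ((h μ hμ).2 T hT).1
    tfae_have 2 → 3 := FockToeplitz.measure_univ_lt_top_of_toeplitzNuclear hc'
      fun T hT => ((h' μ hμ).2 T hT).1
    tfae_have 3 → 1 := (h μ hμ).1
    tfae_have 3 → 2 := (h' μ hμ).1
    tfae_finish
  · refine le_trans ?_ ((h μ hμ).2 T hT).1
    gcongr
    exact min_le_left _ _
  · refine ((h μ hμ).2 T hT).2.trans ?_
    gcongr
    exact le_max_left _ _
  · refine le_trans ?_ ((h' μ hμ).2 T hT).1
    gcongr
    exact min_le_right _ _
  · refine ((h' μ hμ).2 T hT).2.trans ?_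
    gcongr
    exact le_max_right _ _
  · obtain ⟨_, _, _, _, h''⟩ := FockToeplitz.Fock.exists_nuclearNorm_bounds (α := α) hqp' hp'
    exact (h'' μ hμ).1 (FockToeplitz.measure_univ_lt_top_of_toeplitzNuclear hc
      (fun T hT => ((h μ hμ).2 T hT).1) hn)
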